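/- Let $d,J\in\mathbb N$ with $J\ge 2$, and let $\Phi_j(x)=r_jM_jx+a_j$ $(j=1,\dots,J)$ be contraction similitudes of $\mathbb R^d$, with $0<r_j<1$, $M_j\in O(d)$, $a_j\in\mathbb R^d$. Write $\Phi(A)=\bigcup_j\Phi_j(A)$, let $F$ be the attractor (the unique nonempty compact set with $F=\Phi(F)$) and let $C=[F]$ be its convex hull. Assume the tileset condition: $\operatorname{relint}C\not\subseteq\Phi(C)$, and $\operatorname{int}\Phi_j(C)\cap\operatorname{int}\Phi_l(C)=\emptyset$ for $j\ne l$. Assume that $\operatorname{relint}C\setminus\Phi(C)$ has exactly one connected component $G$ (the generator) and that its inradius $g=\sup\{\varepsilon>0: G \text{ contains a ball of radius }\varepsilon\}$ is positive. For a finite word $w=w_1\cdots w_k$, the empty word included, put $\Phi_w=\Phi_{w_k}\circ\cdots\circ\Phi_{w_1}$ and $r_w=r_{w_1}\cdots r_{w_k}$. The self-similar tiling is $\mathcal T=\{\Phi_w(G)\}_w$. For a bounded set $A\subset\mathbb R^d$ let $V(A,\varepsilon)=\operatorname{vol}_d\{x\in A:\operatorname{dist}(x,\partial A)\le\varepsilon\}$,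 and put $V(\mathcal T,\varepsilon)=V\big(\bigcup_w\Phi_w(G),\varepsilon\big)$. Assume that $G$ is monophase: there are constants $\kappa_0,\dots,\kappa_{d-1}\in\mathbb R$ with $V(G,\varepsilon)=\sum_{k=0}^{d-1}\kappa_k\varepsilon^{d-k}$ for $0\le\varepsilon<g$; put $\kappa_d=-\operatorname{vol}_d(G)$. Let $\zeta_s$ (the scaling zeta function) be the meromorphic extension to $\mathbb C$ of $s\mapsto\sum_w r_w^{\,s}$, let $\mathcal D_s$ be its set of poles, and let $$\zeta_{\mathcal T}(\varepsilon,s)=\varepsilon^{d-s}\,\zeta_s(s)\sum_{k=0}^d\frac{g^{s-k}}{s-k}\,\kappa_k$$ be the tubular zeta function. Suppose that $\zeta_{\mathcal T}(\varepsilon,\cdot)$ (for $\varepsilon>0$) and $\zeta_s$ have only simple poles. Then $$V(\mathcal T,\varepsilon)=\sum_{\omega\in\mathcal D_s}\operatorname{res}(\zeta_s;\omega)\,\varepsilon^{d-\omega}\sum_{k=0}^d\frac{g^{\omega-k}}{\omega-k}\,\kappa_k+\sum_{k=0}^{d-1}\kappa_k\,\zeta_s(k)\,\varepsilon^{d-k},$$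 where terms with $\kappa_k=0$ are read as $0$, as an identity of distributions on $0<\varepsilon<g/\min_jr_j$. That is, call a real sequence $(T_n)_{n\in\mathbb Z}$ admissible if $T_{-n}<0<T_n$ for $n\ge1$, $T_n\to\infty$, $T_{-n}\to-\infty$, $T_n/|T_{-n}|\to1$ as $n\to\infty$, and there are $c,M>0$ with $|\zeta_s(\sigma+iT_n)|\le c(|T_n|+1)^M$ for all $n\in\mathbb Z$, $\sigma\in\mathbb R$. Then admissible sequences exist, and for each of them the sets $\{\omega\in\mathcal D_s:T_{-n}<\operatorname{Im}\omega<T_n\}$ are finite and, for every $\varphi\in C_c^\infty\big((0,g/\min_jr_j)\big)$, the function $V(\mathcal T,\cdot)\varphi$ is integrable and $$\int_0^\infty V(\mathcal T,\varepsilon)\varphi(\varepsilon)\,d\varepsilon=\lim_{n\to\infty}\ \sum_{\substack{\omega\in\mathcal D_s\\ T_{-n}<\operatorname{Im}\omega<T_n}}\operatorname{res}(\zeta_s;\omega)\Big(\sum_{k=0}^d\frac{g^{\omega-k}}{\omega-k}\kappa_k\Big)\int_0^\infty\varepsilon^{d-\omega}\varphi(\varepsilon)\,d\varepsilon+\sum_{k=0}^{d-1}\kappa_k\,\zeta_s(k)\int_0^\infty\varepsilon^{d-k}\varphi(\varepsilon)\,d\varepsilon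 .$$ -/

import Mathlib

open Set Filter Topology MeasureTheory
open scoped ContDiff

namespace TubeFormula

/-- `ℝ^d` with its Euclidean metric. -/
abbrev E (d : ℕ) : Type := EuclideanSpace ℝ (Fin d)

/-! ### Self-similar systems and their tilings -/

/-- A self-similar system: `J ≥ 2` contraction similitudes `x ↦ r_j M_j x + a_j` of `ℝ^d`, with
`0 < r_j < 1`, `M_j ∈ O(d)` and `a_j ∈ ℝ^d`. -/
structure SelfSimilarSystem (d J : ℕ) where
  two_le : 2 ≤ J
  ratio : Fin J → ℝ
  ratio_pos : ∀ j, 0 < ratio j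
  ratio_lt_one : ∀ j, ratio j < 1
  rot : Fin J → (E d ≃ₗᵢ[ℝ] E d)
  shift : Fin J → E d

namespace SelfSimilarSystem

variable {d J : ℕ} (S : SelfSimilarSystem d J)

/-- The similitude `Φ_j`. -/
noncomputable def sim (j : Fin J) (x : E d) : E d := S.ratio j • S.rot j x + S.shift j

/-- The set map `Φ(A) = ⋃_j Φ_j(A)`. -/
def setMap (A : Set (E d)) : Set (E d) := ⋃ j, S.sim j '' A

/-- `F` is the attractor: the nonempty compact set with `F = Φ(F)` (there is exactly one). -/
def IsAttractor (F : Set (E d)) : Prop := F.Nonempty ∧ IsCompact F ∧ F = S.setMap F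

/-- `Φ_w = Φ_{w_k} ∘ ⋯ ∘ Φ_{w_1}` for a finite word `w = w_1 ⋯ w_k`; the identity for the empty
word. -/
noncomputable def wordSim : List (Fin J) → E d → E d
  | [] => id
  | j :: w => wordSim w ∘ S.sim j

/-- `r_w = r_{w_1} ⋯ r_{w_k}`; it is `1` for the empty word. -/
def wordRatio (w : List (Fin J)) : ℝ := (w.map S.ratio).prod

/-- The relative interior of the convex hull `[F]`. -/
def tileset (F : Set (E d)) : Set (E d) := intrinsicInterior ℝ (convexHull ℝ F)

/-- The tileset condition for the system with attractor `F`. -/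
def TilesetCondition (F : Set (E d)) : Prop :=
  ¬ (tileset F ⊆ S.setMap (convexHull ℝ F)) ∧
    ∀ j l, j ≠ l →
      interior (S.sim j '' convexHull ℝ F) ∩ interior (S.sim l '' convexHull ℝ F) = ∅

/-- `T_1`: the relative interior of the hull, minus the first iterate of the hull. -/
def tilesetOne (F : Set (E d)) : Set (E d) := tileset F \ S.setMap (convexHull ℝ F)

/-- The generators: the connected components of `T_1`. -/
def generators (F : Set (E d)) : Set (Set (E d)) :=
  {G | ∃ x ∈ S.tilesetOne F, G = connectedComponentIn (S.tilesetOne F) x}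

/-- The self-similar tiling: the collection of all tiles `Φ_w(G)`, with `w` a finite word and `G` a
generator. -/
def tiling (F : Set (E d)) : Set (Set (E d)) :=
  {R | ∃ w : List (Fin J), ∃ G ∈ S.generators F, R = S.wordSim w '' G}

end SelfSimilarSystem

/-! ### Inner neighbourhoods, inradius, monophase generators -/

/-- The inner `ε`-neighbourhood `{x ∈ A | dist(x, ∂A) ≤ ε}`. -/
def innerNhd {d : ℕ} (A : Set (E d)) (ε : ℝ) : Set (E d) :=
  {x ∈ A | Metric.infDist x (frontier A) ≤ ε}

/-- `V(A, ε)`: the `d`-dimensional Lebesgue measure of the inner `ε`-neighbourhood of `A`. -/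
noncomputable def tubeVolume {d : ℕ} (A : Set (E d)) (ε : ℝ) : ℝ := volume.real (innerNhd A ε)

/-- The inradius of `A`. -/
noncomputable def inradius {d : ℕ} (A : Set (E d)) : ℝ :=
  sSup {ε : ℝ | 0 < ε ∧ ∃ x, Metric.ball x ε ⊆ A}

/-- `G` is monophase with the coefficients `κ_0, …, κ_{d-1}`, and `κ_d = -vol_d(G)`. -/
def IsMonophaseWith {d : ℕ} (G : Set (E d)) (κ : ℕ → ℝ) : Prop :=
  (∀ ε : ℝ, 0 ≤ ε → ε < inradius G →
    tubeVolume G ε = ∑ k ∈ Finset.range d, κ k * ε ^ (d - k)) ∧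
  κ d = -volume.real G

/-! ### Meromorphic extension, poles, residues -/

/-- `F` is meromorphic on `ℂ` and agrees with `f` on some right half-plane. The normal form fixes
the values of `F` at single points: `F` is analytic except at its poles, where its value is `0`.
By the identity theorem there is at most one such `F`. -/
def IsMeromorphicExtension (f F : ℂ → ℂ) : Prop :=
  MeromorphicNFOn F univ ∧ ∃ σ : ℝ, ∀ s : ℂ, σ < s.re → F s = f s

/-- The meromorphic extension to `ℂ` of a function given on a right half-plane. -/
noncomputable def meromorphicExtension (f : ℂ → ℂ) : ℂ → ℂ :=
  Classical.epsilon (IsMeromorphicExtension f)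

/-- The set of poles of a meromorphic function. -/
def poles (f : ℂ → ℂ) : Set ℂ := {z | meromorphicOrderAt f z < 0}

/-- Every pole of `f` is simple. -/
def HasOnlySimplePoles (f : ℂ → ℂ) : Prop := ∀ z ∈ poles f, meromorphicOrderAt f z = (-1 : ℤ)

/-- The residue of `f` at `z`: the integral of `f` over small positively oriented circles around
`z`, divided by `2πi` (for meromorphic `f` it does not depend on the radius when that is small). -/
noncomputable def residue (f : ℂ → ℂ) (z : ℂ) : ℂ :=
  limUnder (𝓝[>] (0 : ℝ)) fun ρ : ℝ => (2 * Real.pi * Complex.I : ℂ)⁻¹ * ∮ s in C(z, ρ), f s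

/-! ### Zeta functions -/

/-- The scaling zeta function: the meromorphic extension of `s ↦ ∑_w r_w ^ s`, with the sum over
all finite words. -/
noncomputable def SelfSimilarSystem.scalingZeta {d J : ℕ} (S : SelfSimilarSystem d J) : ℂ → ℂ :=
  meromorphicExtension fun s => ∑' w : List (Fin J), (S.wordRatio w : ℂ) ^ s

/-- The scaling complex dimensions `D_s`: the poles of the scaling zeta function. -/
def SelfSimilarSystem.scalingDims {d J : ℕ} (S : SelfSimilarSystem d J) : Set ℂ :=
  poles S.scalingZeta

/-- The sum `∑_{k=0}^d g^{s-k} / (s-k) κ_k`, for `g` the inradius of `G`. -/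
noncomputable def generatorSum {d : ℕ} (G : Set (E d)) (κ : ℕ → ℝ) (s : ℂ) : ℂ :=
  ∑ k ∈ Finset.range (d + 1), (inradius G : ℂ) ^ (s - k) / (s - k) * κ k

/-- The tubular zeta function of a tiling with the single generator `G`. -/
noncomputable def SelfSimilarSystem.tubularZeta {d J : ℕ} (S : SelfSimilarSystem d J)
    (G : Set (E d)) (κ : ℕ → ℝ) (ε : ℝ) (s : ℂ) : ℂ :=
  (ε : ℂ) ^ ((d : ℂ) - s) * S.scalingZeta s * generatorSum G κ s

/-! ### Truncation heights and test functions -/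

/-- Heights `T_n`, `n ∈ ℤ`, at which the sum over the poles of `f` is cut off: `T_{-n} < 0 < T_n`
for `n ≥ 1`, `T_{±n} → ±∞`, `T_n / |T_{-n}| → 1`, and `f` has at most polynomial growth on the
horizontal lines `Im s = T_n`, uniformly in `Re s`. -/
def IsLanguidSequence (f : ℂ → ℂ) (T : ℤ → ℝ) : Prop :=
  (∀ n : ℕ, 1 ≤ n → T (-n) < 0 ∧ 0 < T n) ∧
  Tendsto (fun n : ℕ => T n) atTop atTop ∧
  Tendsto (fun n : ℕ => T (-n)) atTop atBot ∧
  Tendsto (fun n : ℕ => T n / |T (-n)|) atTop (𝓝 1) ∧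
  ∃ c M : ℝ, 0 < c ∧ 0 < M ∧
    ∀ (n : ℤ) (σ : ℝ), ‖f (σ + T n * Complex.I)‖ ≤ c * (|T n| + 1) ^ M

/-- The points of `D` with imaginary part strictly between `T_{-n}` and `T_n`. -/
def truncated (D : Set ℂ) (T : ℤ → ℝ) (n : ℕ) : Set ℂ :=
  {z ∈ D | T (-n) < z.im ∧ z.im < T n}

/-- `φ` is a smooth test function with compact support contained in `U`. -/
def IsTestFunctionOn (U : Set ℝ) (φ : ℝ → ℂ) : Prop :=
  ContDiff ℝ ∞ φ ∧ HasCompactSupport φ ∧ tsupport φ ⊆ U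

/-- The action `⟨ε^z, φ⟩` of the function `ε ↦ ε^z` on a test function. -/
noncomputable def powPairing (z : ℂ) (φ : ℝ → ℂ) : ℂ := ∫ ε in Ioi (0 : ℝ), (ε : ℂ) ^ z * φ ε

end TubeFormula

open TubeFormula

namespace TubeFormula

/-! ### Integrals over the boundary of a rectangle -/

/-! The tiles `Φ_w(G)` are open, pairwise disjoint and contained in the compact hull `C = [F]`. A
point of a tile is therefore as far from the boundary of the union as from the boundary of its own
tile (`infDist_frontier_iUnion`), and `V(𝒯, ε) = ∑_w r_w^d V(G, ε / r_w)`. The Mellin transform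
turns this sum of rescaled copies into a product: at `s - d` it equals `ζ_s(s) ∑_k g^(s-k) κ_k /
(s-k)` (`hasMellin_tiling`). Comparing the volumes of `G` and of the `Φ_j(C)` inside `C` gives `∑_j
r_j^d < 1` (`moran_lt_one`), so there is a line `Re s = c` with `d - 1 < c < d` on which everything
converges absolutely. Mellin inversion of `φ` and Fubini express `∫ V φ` as an integral over that
line (`integral_tubeVolume_mul`).

The line is then moved to `-∞` (`tendsto_of_rectIntegral`). Since `ζ_s = 1 / (1 - ∑_j r_j^s)`, the
integrand is a finite sum of quotients of entire functions, and the residue theorem on rectangles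
(`rectIntegral_div`) suffices. Zeros of the denominator of `ζ_s` give the sum over `𝒟_s`; the points
`0, …, d-1` give the second sum; the point `d` lies to the right of the line. If such a zero is an
integer `k ≤ d`, then `κ_k = 0`, as otherwise the tubular zeta function has a double pole
(`coeff_eq_zero_of_pole`).

Let `ρ = min_j r_j` and let `φ` be supported in `[a, b]`. Far to the left `|ζ_s(s)| ≤ 2 ρ^(-Re s)`
(`exists_le_norm_denom`), so the integrand is `O((g / (bρ))^(Re s))`. This decays exactly when `b <
g / ρ`, which is the source of the bound `g / min_j r_j`. On the horizontal edges the polynomial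
growth of `ζ_s` is beaten by the rapid decay of the Mellin transform of `φ`
(`exists_norm_powPairing_le`).

Admissible heights exist because `1 - ∑_j r_j^s` is almost periodic in the vertical direction
(`exists_heights`): a horizontal line without zeros has translates, arbitrarily high, on which the
function is almost the same. -/

/-- The integral of `f` over the positively oriented boundary of `[a, b] × [c, e]`. -/
noncomputable def rectIntegral (f : ℂ → ℂ) (a b c e : ℝ) : ℂ :=
  (∫ x in a..b, f (x + c * Complex.I)) - (∫ x in a..b, f (x + e * Complex.I)) +
    Complex.I * (∫ y in c..e, f (b + y * Complex.I)) -
    Complex.I * ∫ y in c..e, f (a + y * Complex.I)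

/-- The boundary of the rectangle `[a, b] × [c, e]`. -/
def rectBoundary (a b c e : ℝ) : Set ℂ :=
  {s | (s.re ∈ Icc a b ∧ (s.im = c ∨ s.im = e)) ∨ (s.im ∈ Icc c e ∧ (s.re = a ∨ s.re = b))}

lemma rectIntegral_congr {f h : ℂ → ℂ} {a b c e : ℝ} (hab : a ≤ b) (hce : c ≤ e)
    (hfh : EqOn f h (rectBoundary a b c e)) : rectIntegral f a b c e = rectIntegral h a b c e := by
  unfold rectIntegral
  congr 1
  · congr 1
    · congr 1 <;>
      · refine intervalIntegral.integral_congr fun x hx => ?_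
        rw [uIcc_of_le hab] at hx
        exact hfh (Or.inl ⟨by simpa using hx, by simp⟩)
    · congr 1
      refine intervalIntegral.integral_congr fun x hx => ?_
      rw [uIcc_of_le hce] at hx
      exact hfh (Or.inr ⟨by simpa using hx, by simp⟩)
  · congr 1
    refine intervalIntegral.integral_congr fun x hx => ?_
    rw [uIcc_of_le hce] at hx
    exact hfh (Or.inr ⟨by simpa using hx, by simp⟩)

lemma intervalIntegrable_horizontal {f : ℂ → ℂ} {a b c e : ℝ} (hab : a ≤ b)
    (hf : ContinuousOn f (rectBoundary a b c e)) {y : ℝ} (hy : y = c ∨ y = e) :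
    IntervalIntegrable (fun x : ℝ => f (x + y * Complex.I)) volume a b := by
  refine ContinuousOn.intervalIntegrable ?_
  refine hf.comp (by fun_prop) fun x hx => ?_
  rw [uIcc_of_le hab] at hx
  exact Or.inl ⟨by simpa using hx, by simpa using hy⟩

lemma intervalIntegrable_vertical {f : ℂ → ℂ} {a b c e : ℝ} (hce : c ≤ e)
    (hf : ContinuousOn f (rectBoundary a b c e)) {x : ℝ} (hx : x = a ∨ x = b) :
    IntervalIntegrable (fun y : ℝ => f (x + y * Complex.I)) volume c e := by
  refine ContinuousOn.intervalIntegrable ?_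
  refine hf.comp (by fun_prop) fun y hy => ?_
  rw [uIcc_of_le hce] at hy
  exact Or.inr ⟨by simpa using hy, by simpa using hx⟩

lemma rectIntegral_add {f h : ℂ → ℂ} {a b c e : ℝ} (hab : a ≤ b) (hce : c ≤ e)
    (hf : ContinuousOn f (rectBoundary a b c e)) (hh : ContinuousOn h (rectBoundary a b c e)) :
    rectIntegral (fun s => f s + h s) a b c e = rectIntegral f a b c e + rectIntegral h a b c e := by
  unfold rectIntegral
  rw [intervalIntegral.integral_add (intervalIntegrable_horizontal hab hf (.inl rfl))
      (intervalIntegrable_horizontal hab hh (.inl rfl)),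
    intervalIntegral.integral_add (intervalIntegrable_horizontal hab hf (.inr rfl))
      (intervalIntegrable_horizontal hab hh (.inr rfl)),
    intervalIntegral.integral_add (intervalIntegrable_vertical hce hf (.inl rfl))
      (intervalIntegrable_vertical hce hh (.inl rfl)),
    intervalIntegral.integral_add (intervalIntegrable_vertical hce hf (.inr rfl))
      (intervalIntegrable_vertical hce hh (.inr rfl))]
  ring

lemma rectIntegral_zero (a b c e : ℝ) : rectIntegral (fun _ => 0) a b c e = 0 := by
  simp [rectIntegral]

lemma rectIntegral_sum {ι : Type*} (t : Finset ι) {f : ι → ℂ → ℂ} {a b c e : ℝ} (hab : a ≤ b)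
    (hce : c ≤ e) (hf : ∀ i ∈ t, ContinuousOn (f i) (rectBoundary a b c e)) :
    rectIntegral (fun s => ∑ i ∈ t, f i s) a b c e = ∑ i ∈ t, rectIntegral (f i) a b c e := by
  classical
  induction t using Finset.induction_on with
  | empty => simpa using rectIntegral_zero a b c e
  | insert i t hi ih =>
    simp only [Finset.sum_insert hi]
    rw [rectIntegral_add hab hce (hf i (Finset.mem_insert_self i t)), ih]
    · exact fun j hj => hf j (Finset.mem_insert_of_mem hj)
    · exact continuousOn_finsetSum _ fun j hj => hf j (Finset.mem_insert_of_mem hj)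

lemma rectIntegral_const_mul (k : ℂ) (f : ℂ → ℂ) (a b c e : ℝ) :
    rectIntegral (fun s => k * f s) a b c e = k * rectIntegral f a b c e := by
  unfold rectIntegral
  simp only [intervalIntegral.integral_const_mul]
  ring

lemma rectIntegral_eq_zero {f : ℂ → ℂ} {a b c e : ℝ}
    (hab : a ≤ b) (hce : c ≤ e) (hf : DifferentiableOn ℂ f (Icc a b ×ℂ Icc c e)) :
    rectIntegral f a b c e = 0 := by
  have := Complex.integral_boundary_rect_eq_zero_of_differentiableOn f ⟨a, c⟩ ⟨b, e⟩
    (by simpa [uIcc_of_le hab, uIcc_of_le hce] using hf)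
  simpa [rectIntegral, smul_eq_mul] using this

/-- Primitives of `1 / (s - w)` are used on each side. On the bottom, right and top sides `s - w`
avoids the branch cut of `log`; on the left side `-(s - w)` does. The switch between `log z` and
`log (-z)` at the two left corners contributes `πi` each. -/
lemma rectIntegral_inv_sub {a b c e : ℝ} {w : ℂ} (hre : w.re ∈ Ioo a b) (him : w.im ∈ Ioo c e) :
    rectIntegral (fun s => (s - w)⁻¹) a b c e = 2 * Real.pi * Complex.I := by
  have hlog : ∀ (u : ℝ → ℂ) (u' : ℂ) (p q : ℝ), (∀ x, HasDerivAt u u' x) →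
      (∀ x ∈ uIcc p q, u x ∈ Complex.slitPlane) →
      ∫ x in p..q, u' / u x = Complex.log (u q) - Complex.log (u p) := by
    intro u u' p q hu hs
    refine intervalIntegral.integral_eq_sub_of_hasDerivAt
      (f := fun x => Complex.log (u x)) (fun x hx => (hu x).clog_real (hs x hx)) ?_
    refine ContinuousOn.intervalIntegrable ?_
    refine continuousOn_const.div (fun x _ => (hu x).continuousAt.continuousWithinAt) ?_
    exact fun x hx => Complex.slitPlane_ne_zero (hs x hx)
  have hH : ∀ y : ℝ, ∀ x : ℝ, HasDerivAt (fun x : ℝ => (x : ℂ) + y * Complex.I - w) 1 x := by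
    intro y x
    simpa using ((Complex.ofRealCLM.hasDerivAt (x := x)).add_const (y * Complex.I)).sub_const w
  have hV : ∀ x : ℝ, ∀ y : ℝ,
      HasDerivAt (fun y : ℝ => (x : ℂ) + y * Complex.I - w) Complex.I y := by
    intro x y
    simpa using (((Complex.ofRealCLM.hasDerivAt (x := y)).mul_const Complex.I).const_add
      (x : ℂ)).sub_const w
  have hB := hlog _ _ a b (hH c) fun x _ => Or.inr (by simp; linarith [him.1])
  have hT := hlog _ _ a b (hH e) fun x _ => Or.inr (by simp; linarith [him.2])
  have hR := hlog _ _ c e (hV b) fun x _ => Or.inl (by simp; linarith [hre.2])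
  have hL := hlog _ _ c e (fun y => (hV a y).fun_neg) fun x _ => Or.inl (by simp; linarith [hre.1])
  have n1 : Complex.log (-((a : ℂ) + e * Complex.I - w)) =
      Complex.log ((a : ℂ) + e * Complex.I - w) - Real.pi * Complex.I := by
    have : 0 < ((a : ℂ) + e * Complex.I - w).im := by simp; linarith [him.2]
    simp only [Complex.log, norm_neg, Complex.arg_neg_eq_arg_sub_pi_of_im_pos this]
    push_cast; ring
  have n2 : Complex.log (-((a : ℂ) + c * Complex.I - w)) =
      Complex.log ((a : ℂ) + c * Complex.I - w) + Real.pi * Complex.I := by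
    have : ((a : ℂ) + c * Complex.I - w).im < 0 := by simp; linarith [him.1]
    simp only [Complex.log, norm_neg, Complex.arg_neg_eq_arg_add_pi_of_im_neg this]
    push_cast; ring
  rw [n1, n2] at hL
  simp only [neg_div_neg_eq] at hL
  simp only [div_eq_mul_inv, one_mul, intervalIntegral.integral_const_mul] at hB hT hR hL
  rw [rectIntegral, hB, hT, hR, hL]
  ring

/-! ### Residues of quotients of entire functions at simple poles -/

lemma entire_dslope {f : ℂ → ℂ} (hf : Differentiable ℂ f) (w : ℂ) :
    Differentiable ℂ (dslope f w) := by
  rw [← differentiableOn_univ] at hf ⊢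
  exact (Complex.differentiableOn_dslope univ_mem).2 hf

lemma eq_sub_mul_dslope {f : ℂ → ℂ} {w : ℂ} (hw : f w = 0) (s : ℂ) :
    f s = (s - w) * dslope f w s := by
  have := sub_smul_dslope f w s
  rw [hw, sub_zero, smul_eq_mul] at this
  exact this.symm

lemma deriv_eq_of_eq_sub_mul {f h : ℂ → ℂ} {w z : ℂ} (hh : Differentiable ℂ h)
    (hf : ∀ s, f s = (s - w) * h s) : deriv f z = h z + (z - w) * deriv h z := by
  have h1 : HasDerivAt f (1 * h z + (z - w) * deriv h z) z := by
    rw [show f = fun s => (s - w) * h s from funext hf]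
    exact ((hasDerivAt_id z).sub_const w).mul (hh z).hasDerivAt
  simpa using h1.deriv

/-- Residue theorem by peeling off one simple zero `w` at a time: with `D = (s - w) D₁` and `k = A w
/ D' w`, the function `A - k D₁` vanishes at `w`, hence equals `(s - w) A₁`, and `A / D = A₁ / D₁ +
k / (s - w)`. The remaining residues do not change, because `A = (s - w) A₁` and `D' = (s - w) D₁'`
at the other zeros. -/
lemma rectIntegral_div {a b c e : ℝ} (hab : a ≤ b) (hce : c ≤ e) (Z : Finset ℂ) :
    ∀ {A D : ℂ → ℂ}, Differentiable ℂ A → Differentiable ℂ D →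
      (∀ s ∈ Icc a b ×ℂ Icc c e, D s = 0 ↔ s ∈ Z) →
      (∀ w ∈ Z, w.re ∈ Ioo a b ∧ w.im ∈ Ioo c e) → (∀ w ∈ Z, deriv D w ≠ 0) →
      rectIntegral (fun s => A s / D s) a b c e =
        2 * Real.pi * Complex.I * ∑ w ∈ Z, A w / deriv D w := by
  classical
  have hsub : rectBoundary a b c e ⊆ Icc a b ×ℂ Icc c e := by
    rintro s (⟨h1, h2 | h2⟩ | ⟨h1, h2 | h2⟩)
    · exact ⟨h1, by simp [h2, hce]⟩
    · exact ⟨h1, by simp [h2, hce]⟩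
    · exact ⟨by simp [h2, hab], h1⟩
    · exact ⟨by simp [h2, hab], h1⟩
  -- `A` and `D` stay universally quantified, since the induction step replaces both.
  induction Z using Finset.induction_on with
  | empty =>
    intro A D hA hD hZ _ _
    rw [rectIntegral_eq_zero hab hce]
    · simp
    · refine hA.differentiableOn.div hD.differentiableOn fun s hs h0 => ?_
      simpa using (hZ s hs).1 h0
  | insert w Z hw ih =>
    intro A D hA hD hZ hin hd
    have hwin := hin w (Finset.mem_insert_self w Z)
    have hDw : D w = 0 :=
      (hZ w ⟨Ioo_subset_Icc_self hwin.1, Ioo_subset_Icc_self hwin.2⟩).2 (Finset.mem_insert_self w Z)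
    set D₁ := dslope D w with hD₁
    have hD₁d : Differentiable ℂ D₁ := entire_dslope hD w
    have hDeq : ∀ s, D s = (s - w) * D₁ s := eq_sub_mul_dslope hDw
    have hD₁w : D₁ w = deriv D w := dslope_same D w
    have hD₁w0 : D₁ w ≠ 0 := by rw [hD₁w]; exact hd w (Finset.mem_insert_self w Z)
    set k := A w / deriv D w with hk
    set B : ℂ → ℂ := fun s => A s - k * D₁ s with hB
    have hBd : Differentiable ℂ B := hA.sub (hD₁d.const_mul k)
    have hBw : B w = 0 := by
      simp only [hB, hk, hD₁w]
      rw [div_mul_cancel₀ _ (by rwa [← hD₁w]), sub_self]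
    set A₁ := dslope B w
    have hA₁d : Differentiable ℂ A₁ := entire_dslope hBd w
    have hBeq : ∀ s, B s = (s - w) * A₁ s := eq_sub_mul_dslope hBw
    have hZ₁ : ∀ s ∈ Icc a b ×ℂ Icc c e, D₁ s = 0 ↔ s ∈ Z := by
      intro s hs
      by_cases hsw : s = w
      · subst hsw
        simp [hD₁w0, hw]
      · have := hZ s hs
        rw [hDeq, mul_eq_zero, sub_eq_zero, Finset.mem_insert] at this
        simpa [hsw] using this
    have hmem : ∀ z ∈ Z, D₁ z = 0 ∧ z - w ≠ 0 := by
      intro z hz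
      have h2 := hin z (Finset.mem_insert_of_mem hz)
      refine ⟨(hZ₁ z ⟨Ioo_subset_Icc_self h2.1, Ioo_subset_Icc_self h2.2⟩).2 hz, fun h => hw ?_⟩
      rwa [← sub_eq_zero.1 h]
    have hder : ∀ z ∈ Z, deriv D z = (z - w) * deriv D₁ z := by
      intro z hz
      rw [deriv_eq_of_eq_sub_mul hD₁d hDeq, (hmem z hz).1, zero_add]
    have hrec := ih hA₁d hD₁d hZ₁ (fun z hz => hin z (Finset.mem_insert_of_mem hz))
      fun z hz h0 => hd z (Finset.mem_insert_of_mem hz) (by rw [hder z hz, h0, mul_zero])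
    have hne : ∀ s ∈ rectBoundary a b c e, D₁ s ≠ 0 ∧ s - w ≠ 0 := by
      intro s hs
      have hbd : ¬ (s.re ∈ Ioo a b ∧ s.im ∈ Ioo c e) := by
        rintro ⟨h1, h2⟩
        rcases hs with ⟨_, h | h⟩ | ⟨_, h | h⟩
        · exact absurd h h2.1.ne'
        · exact absurd h h2.2.ne
        · exact absurd h h1.1.ne'
        · exact absurd h h1.2.ne
      have : s ∉ insert w Z := fun h => hbd (hin s h)
      rw [← hZ s (hsub hs), hDeq, mul_eq_zero, not_or] at this
      exact ⟨this.2, this.1⟩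
    have hcongr : EqOn (fun s => A s / D s) (fun s => A₁ s / D₁ s + k * (s - w)⁻¹)
        (rectBoundary a b c e) := by
      intro s hs
      obtain ⟨h1, h2⟩ := hne s hs
      have h3 : A s = (s - w) * A₁ s + k * D₁ s := by rw [← hBeq]; simp [hB]
      simp only [h3, hDeq s]
      field_simp
    rw [rectIntegral_congr hab hce hcongr, rectIntegral_add hab hce, hrec, rectIntegral_const_mul,
      rectIntegral_inv_sub hwin.1 hwin.2, Finset.sum_insert hw, mul_add]
    · rw [add_comm, mul_comm k]
      congr 2
      refine Finset.sum_congr rfl fun z hz => ?_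
      obtain ⟨h1, h2⟩ := hmem z hz
      have h3 : A z = (z - w) * A₁ z := by rw [← hBeq]; simp [hB, h1]
      rw [h3, hder z hz, mul_div_mul_left _ _ h2]
    · exact hA₁d.continuous.continuousOn.div hD₁d.continuous.continuousOn fun s hs => (hne s hs).1
    · exact continuousOn_const.mul ((continuous_id.sub continuous_const).continuousOn.inv₀
        fun s hs => (hne s hs).2)

/-- On small circles this is Cauchy's formula for the reciprocal of `dslope f w`, which is
holomorphic and nonzero near `w`. -/
lemma residue_inv {f : ℂ → ℂ} (hf : Differentiable ℂ f) {w : ℂ} (hw : f w = 0)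
    (hd : deriv f w ≠ 0) : residue (fun s => (f s)⁻¹) w = (deriv f w)⁻¹ := by
  have hh : Differentiable ℂ (dslope f w) := entire_dslope hf w
  have hw1 : dslope f w w = deriv f w := dslope_same f w
  have hev : ∀ᶠ s in 𝓝 w, dslope f w s ≠ 0 :=
    (hh.continuous.continuousAt (x := w)).eventually_ne (by rwa [hw1])
  obtain ⟨δ, hδ, hball⟩ := Metric.eventually_nhds_iff_ball.1 hev
  refine Tendsto.limUnder_eq (tendsto_const_nhds.congr' ?_)
  filter_upwards [Ioo_mem_nhdsGT hδ] with ρ hρ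
  have hdiff : DifferentiableOn ℂ (fun s => (dslope f w s)⁻¹) (Metric.closedBall w ρ) := by
    refine hh.differentiableOn.inv fun s hs => hball s ?_
    exact Metric.closedBall_subset_ball hρ.2 hs
  have := hdiff.circleIntegral_sub_inv_smul (Metric.mem_ball_self hρ.1)
  have hcong : ∀ s, (f s)⁻¹ = (s - w)⁻¹ • (dslope f w s)⁻¹ := fun s => by
    rw [eq_sub_mul_dslope hw s, mul_inv, smul_eq_mul]
  simp only [hcong]
  rw [this, hw1, smul_eq_mul, ← mul_assoc, inv_mul_cancel₀ Complex.two_pi_I_ne_zero, one_mul]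

/-! ### Sums over all finite words -/

lemma summable_list_prod_of_nonneg {n : ℕ} {y : Fin n → ℝ} (h0 : ∀ j, 0 ≤ y j)
    (h1 : ∑ j, y j < 1) : Summable fun w : List (Fin n) => (w.map y).prod := by
  have hs0 : 0 ≤ ∑ j, y j := Finset.sum_nonneg fun j _ => h0 j
  -- Words are grouped by length; those of length `k` contribute the `k`-th power of `∑ j, y j`.
  rw [← List.equivSigmaTuple.symm.summable_iff]
  rw [summable_sigma_of_nonneg]
  · refine ⟨fun k => (hasSum_fintype _).summable, ?_⟩
    have : ∀ k : ℕ, (∑' f : Fin k → Fin n,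
        ((fun w : List (Fin n) => (w.map y).prod) ∘ List.equivSigmaTuple.symm) ⟨k, f⟩) =
        (∑ j, y j) ^ k := by
      intro k
      rw [tsum_fintype, Fintype.sum_pow]
      refine Finset.sum_congr rfl fun f _ => ?_
      simp [List.equivSigmaTuple, List.prod_ofFn, List.map_ofFn]
    simp only [this]
    exact summable_geometric_of_lt_one hs0 h1
  · intro w
    refine List.prod_nonneg fun a ha => ?_
    obtain ⟨j, _, rfl⟩ := List.mem_map.1 ha
    exact h0 j

lemma norm_list_prod_map {n : ℕ} (x : Fin n → ℂ) (w : List (Fin n)) :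
    ‖(w.map x).prod‖ = (w.map fun j => ‖x j‖).prod := by
  induction w with
  | nil => simp
  | cons j w ih => simp [ih]

lemma hasSum_list_prod {n : ℕ} {x : Fin n → ℂ} (h1 : ∑ j, ‖x j‖ < 1) :
    HasSum (fun w : List (Fin n) => (w.map x).prod) (1 - ∑ j, x j)⁻¹ := by
  have hsum : Summable fun w : List (Fin n) => (w.map x).prod := by
    refine Summable.of_norm ?_
    simpa only [norm_list_prod_map] using
      summable_list_prod_of_nonneg (fun j => norm_nonneg (x j)) h1
  rw [← List.equivSigmaTuple.symm.hasSum_iff]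
  have hs2 := List.equivSigmaTuple.symm.summable_iff.2 hsum
  have hg : HasSum (fun k : ℕ => (∑ j, x j) ^ k) (1 - ∑ j, x j)⁻¹ :=
    hasSum_geometric_of_norm_lt_one ((norm_sum_le _ _).trans_lt h1)
  refine HasSum.sigma_of_hasSum hg (fun k => ?_) hs2
  rw [Fintype.sum_pow]
  convert hasSum_fintype _ using 1
  refine Finset.sum_congr rfl fun f _ => ?_
  simp [List.equivSigmaTuple, List.prod_ofFn, List.map_ofFn]

namespace SelfSimilarSystem

variable {d J : ℕ} (S : SelfSimilarSystem d J)

/-- The Moran function `σ ↦ ∑_j r_j ^ σ`. -/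
noncomputable def moran (σ : ℝ) : ℝ := ∑ j, S.ratio j ^ σ

/-- The denominator `1 - ∑_j r_j ^ s` of the scaling zeta function. -/
noncomputable def denom (s : ℂ) : ℂ := 1 - ∑ j, (S.ratio j : ℂ) ^ s

lemma wordRatio_pos (w : List (Fin J)) : 0 < S.wordRatio w := by
  refine List.prod_pos fun a ha => ?_
  obtain ⟨j, _, rfl⟩ := List.mem_map.1 ha
  exact S.ratio_pos j

lemma wordRatio_cpow (w : List (Fin J)) (s : ℂ) :
    (S.wordRatio w : ℂ) ^ s = (w.map fun j => (S.ratio j : ℂ) ^ s).prod := by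
  induction w with
  | nil => simp [wordRatio]
  | cons j w ih =>
    rw [List.map_cons, List.prod_cons, ← ih, ← Complex.mul_cpow_ofReal_nonneg (S.ratio_pos j).le
      (S.wordRatio_pos w).le]
    simp [wordRatio]

lemma norm_ratio_cpow (j : Fin J) (s : ℂ) : ‖(S.ratio j : ℂ) ^ s‖ = S.ratio j ^ s.re :=
  Complex.norm_cpow_eq_rpow_re_of_pos (S.ratio_pos j) s

lemma hasSum_wordRatio_cpow {s : ℂ} (hs : S.moran s.re < 1) :
    HasSum (fun w : List (Fin J) => (S.wordRatio w : ℂ) ^ s) (S.denom s)⁻¹ := by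
  simp only [wordRatio_cpow]
  exact hasSum_list_prod (by simpa only [norm_ratio_cpow, moran] using hs)

lemma summable_wordRatio_rpow {σ : ℝ} (hσ : S.moran σ < 1) :
    Summable fun w : List (Fin J) => S.wordRatio w ^ σ := by
  have := (S.hasSum_wordRatio_cpow (s := σ) (by simpa using hσ)).summable.norm
  refine this.congr fun w => ?_
  rw [Complex.norm_cpow_eq_rpow_re_of_pos (S.wordRatio_pos w), Complex.ofReal_re]

/-! ### The denominator of the scaling zeta function -/

lemma differentiable_denom : Differentiable ℂ S.denom := by
  unfold denom
  refine (differentiable_const _).sub (Differentiable.fun_sum fun j _ => ?_)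
  intro s
  exact (differentiableAt_id.const_cpow
    (Or.inl (by exact_mod_cast (S.ratio_pos j).ne')))

lemma moran_antitone : Antitone S.moran := fun _ _ h =>
  Finset.sum_le_sum fun j _ => Real.rpow_le_rpow_of_exponent_ge (S.ratio_pos j)
    (S.ratio_lt_one j).le h

lemma moran_nonneg (σ : ℝ) : 0 ≤ S.moran σ :=
  Finset.sum_nonneg fun j _ => (Real.rpow_pos_of_pos (S.ratio_pos j) σ).le

lemma continuous_moran : Continuous S.moran := by
  unfold moran
  refine continuous_finsetSum _ fun j _ => ?_
  exact Real.continuous_const_rpow (S.ratio_pos j).ne'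

lemma tendsto_moran_atTop : Tendsto S.moran atTop (𝓝 0) := by
  unfold moran
  rw [← Finset.sum_const_zero (s := (Finset.univ : Finset (Fin J)))]
  exact tendsto_finsetSum _ fun j _ => tendsto_rpow_atTop_of_base_lt_one _
    (by linarith [S.ratio_pos j]) (S.ratio_lt_one j)

lemma norm_sum_cpow_le (s : ℂ) : ‖∑ j, (S.ratio j : ℂ) ^ s‖ ≤ S.moran s.re := by
  refine (norm_sum_le _ _).trans ?_
  simp only [norm_ratio_cpow]
  exact le_rfl

lemma one_sub_moran_le (s : ℂ) : 1 - S.moran s.re ≤ ‖S.denom s‖ := by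
  have h1 := norm_sub_norm_le (1 : ℂ) (∑ j, (S.ratio j : ℂ) ^ s)
  have h2 := S.norm_sum_cpow_le s
  rw [norm_one] at h1
  unfold denom
  linarith

lemma denom_ne_zero {s : ℂ} (hs : S.moran s.re < 1) : S.denom s ≠ 0 := by
  have := S.one_sub_moran_le s
  intro h
  rw [h, norm_zero] at this
  linarith

lemma exists_min_ratio : ∃ j₀, ∀ j, S.ratio j₀ ≤ S.ratio j := by
  have : Nonempty (Fin J) := ⟨⟨0, by linarith [S.two_le]⟩⟩
  exact Finite.exists_min S.ratio

/-- As `Re s → -∞` the terms with the smallest ratio dominate both `1` and all other terms. Indices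
sharing that ratio give equal terms, so they cannot cancel each other. -/
lemma exists_le_norm_denom {j₀ : Fin J} (hj : ∀ j, S.ratio j₀ ≤ S.ratio j) :
    ∃ σ₀ : ℝ, σ₀ ≤ 0 ∧ ∀ s : ℂ, s.re ≤ σ₀ → S.ratio j₀ ^ s.re / 2 ≤ ‖S.denom s‖ := by
  classical
  set ρ := S.ratio j₀ with hρ
  have hρ0 : 0 < ρ := S.ratio_pos j₀
  set K := Finset.univ.filter fun j => S.ratio j = ρ with hK
  set L := Finset.univ.filter fun j => ¬ S.ratio j = ρ with hL
  have hcard : 1 ≤ (K.card : ℝ) := by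
    exact_mod_cast Finset.card_pos.2 ⟨j₀, by simp [hK, hρ]⟩
  -- The constant `1` and the terms with larger ratios, measured relative to `ρ ^ σ`.
  have hlim : Tendsto (fun σ : ℝ => ρ ^ (-σ) + ∑ j ∈ L, (ρ / S.ratio j) ^ (-σ)) atBot
      (𝓝 (0 + ∑ j ∈ L, 0)) := by
    refine Tendsto.add ?_ (tendsto_finsetSum _ fun j hjL => ?_)
    · exact (tendsto_rpow_atTop_of_base_lt_one _ (by linarith) (S.ratio_lt_one j₀)).comp
        tendsto_neg_atBot_atTop
    · have h1 : ρ < S.ratio j := lt_of_le_of_ne (hj j) fun h => by simp [hL, h] at hjL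
      have h2 : 0 < ρ / S.ratio j := div_pos hρ0 (S.ratio_pos j)
      exact (tendsto_rpow_atTop_of_base_lt_one _ (by linarith)
        ((div_lt_one (S.ratio_pos j)).2 h1)).comp tendsto_neg_atBot_atTop
  simp only [Finset.sum_const_zero, add_zero] at hlim
  have hev := (hlim.eventually (gt_mem_nhds (show (0 : ℝ) < 1 / 2 by norm_num))).and
    (eventually_le_atBot (0 : ℝ))
  obtain ⟨σ₀, hσ₀⟩ := eventually_atBot.1 hev
  refine ⟨σ₀, (hσ₀ σ₀ le_rfl).2, fun s hs => ?_⟩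
  obtain ⟨h1, -⟩ := hσ₀ s.re hs
  have hpos : 0 < ρ ^ s.re := Real.rpow_pos_of_pos hρ0 _
  have hKs : ∑ j ∈ K, (S.ratio j : ℂ) ^ s = K.card * (ρ : ℂ) ^ s := by
    rw [Finset.sum_congr rfl (g := fun _ => (ρ : ℂ) ^ s), Finset.sum_const, nsmul_eq_mul]
    intro j hjK
    rw [(Finset.mem_filter.1 hjK).2]
  have hsplit : ∑ j, (S.ratio j : ℂ) ^ s = K.card * (ρ : ℂ) ^ s + ∑ j ∈ L, (S.ratio j : ℂ) ^ s := by
    rw [← hKs, Finset.sum_filter_add_sum_filter_not]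
  have hL1 : ‖∑ j ∈ L, (S.ratio j : ℂ) ^ s‖ ≤ ∑ j ∈ L, S.ratio j ^ s.re := by
    refine (norm_sum_le _ _).trans ?_
    simp only [norm_ratio_cpow]
    exact le_rfl
  have hL2 : ∑ j ∈ L, S.ratio j ^ s.re = ρ ^ s.re * ∑ j ∈ L, (ρ / S.ratio j) ^ (-s.re) := by
    rw [Finset.mul_sum]
    refine Finset.sum_congr rfl fun j _ => ?_
    rw [Real.div_rpow hρ0.le (S.ratio_pos j).le, Real.rpow_neg hρ0.le,
      Real.rpow_neg (S.ratio_pos j).le]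
    have := (Real.rpow_pos_of_pos (S.ratio_pos j) s.re).ne'
    field_simp
  have hK1 : ρ ^ s.re ≤ ‖(K.card : ℂ) * (ρ : ℂ) ^ s‖ := by
    rw [norm_mul, Complex.norm_cpow_eq_rpow_re_of_pos hρ0, Complex.norm_natCast]
    nlinarith
  have h1' : ρ ^ s.re * ρ ^ (-s.re) = 1 := by
    rw [← Real.rpow_add hρ0]; simp
  have htri : ‖(K.card : ℂ) * (ρ : ℂ) ^ s‖ ≤
      ‖S.denom s‖ + 1 + ‖∑ j ∈ L, (S.ratio j : ℂ) ^ s‖ := by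
    have : (K.card : ℂ) * (ρ : ℂ) ^ s = (1 - S.denom s) - ∑ j ∈ L, (S.ratio j : ℂ) ^ s := by
      rw [denom, hsplit]; ring
    rw [this]
    refine (norm_sub_le _ _).trans ?_
    have := norm_sub_le (1 : ℂ) (S.denom s)
    rw [norm_one] at this
    linarith
  have : ρ ^ s.re * (ρ ^ (-s.re) + ∑ j ∈ L, (ρ / S.ratio j) ^ (-s.re)) ≤ ρ ^ s.re * (1 / 2) :=
    mul_le_mul_of_nonneg_left h1.le hpos.le
  rw [mul_add, h1', ← hL2] at this
  linarith

lemma exists_zeros_subset_strip :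
    ∃ σ₀ σ₁ : ℝ, σ₀ ≤ 0 ∧ ∀ s : ℂ, S.denom s = 0 → σ₀ < s.re ∧ s.re < σ₁ := by
  obtain ⟨j₀, hj₀⟩ := S.exists_min_ratio
  obtain ⟨σ₀, hσ₀, hl⟩ := S.exists_le_norm_denom hj₀
  obtain ⟨σ₁, hσ₁⟩ := (S.tendsto_moran_atTop.eventually (gt_mem_nhds one_pos)).exists
  refine ⟨σ₀, σ₁, hσ₀, fun s hs => ⟨?_, ?_⟩⟩
  · by_contra! h
    have := hl s h
    rw [hs, norm_zero] at this
    linarith [Real.rpow_pos_of_pos (S.ratio_pos j₀) s.re]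
  · by_contra! h
    exact S.denom_ne_zero ((S.moran_antitone h).trans_lt hσ₁) hs

lemma exists_denom_ne_zero : ∃ s, S.denom s ≠ 0 := by
  obtain ⟨σ₁, hσ₁⟩ := (S.tendsto_moran_atTop.eventually (gt_mem_nhds one_pos)).exists
  exact ⟨σ₁, S.denom_ne_zero (by simpa using hσ₁)⟩

lemma analyticOnNhd_denom : AnalyticOnNhd ℂ S.denom univ :=
  fun s _ => S.differentiable_denom.analyticAt s

/-- The zeros lie in a vertical strip, so those of bounded height lie in a compact rectangle;
infinitely many of them would accumulate and force `denom` to vanish identically. -/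
lemma finite_zeros (T₁ T₂ : ℝ) : {s | S.denom s = 0 ∧ s.im ∈ Icc T₁ T₂}.Finite := by
  obtain ⟨σ₀, σ₁, -, hstrip⟩ := S.exists_zeros_subset_strip
  by_contra hinf
  have hK : IsCompact (Icc σ₀ σ₁ ×ℂ Icc T₁ T₂) := isCompact_Icc.reProdIm isCompact_Icc
  obtain ⟨z, -, hz⟩ := Set.Infinite.exists_accPt_of_subset_isCompact hinf hK
    fun s hs => ⟨⟨(hstrip s hs.1).1.le, (hstrip s hs.1).2.le⟩, hs.2⟩
  obtain ⟨s, hs⟩ := S.exists_denom_ne_zero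
  refine hs (S.analyticOnNhd_denom.eqOn_zero_of_preconnected_of_frequently_eq_zero
    isPreconnected_univ (mem_univ z) ?_ (mem_univ s))
  exact (accPt_iff_frequently_nhdsNE.1 hz).mono fun y hy => hy.1

/-- Since `0⁻¹ = 0`, the bound says nothing at a zero itself. But near a zero on the line `‖denom‖`
would take small positive values, where the inverse exceeds `K`. -/
lemma denom_ne_zero_of_bounded {T K : ℝ}
    (h : ∀ σ : ℝ, ‖(S.denom (σ + T * Complex.I))⁻¹‖ ≤ K) (σ : ℝ) :
    S.denom (σ + T * Complex.I) ≠ 0 := by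
  intro h0
  obtain ⟨σ₁, hσ₁⟩ := (S.tendsto_moran_atTop.eventually (gt_mem_nhds one_pos)).exists
  have hne : S.denom (σ₁ + T * Complex.I) ≠ 0 := S.denom_ne_zero (by simpa using hσ₁)
  have hpos : 0 < ‖S.denom (σ₁ + T * Complex.I)‖ := norm_pos_iff.2 hne
  have hK : 0 < K := lt_of_lt_of_le (by simpa using hne) (h σ₁)
  have hcont : Continuous fun x : ℝ => ‖S.denom (x + T * Complex.I)‖ :=
    (S.differentiable_denom.continuous.comp (by fun_prop)).norm
  -- A positive value at most `1 / (2 * K)`, lying between the value `0` at the zero and the value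
  -- at `σ₁`, hence attained.
  set m := min ‖S.denom (σ₁ + T * Complex.I)‖ (1 / (2 * K)) with hm
  have hm0 : 0 < m := lt_min hpos (by positivity)
  obtain ⟨x, hx⟩ := mem_range_of_exists_le_of_exists_ge hcont (c := m)
    ⟨σ, by simp [h0, hm0.le]⟩ ⟨σ₁, min_le_left _ _⟩
  have h1 := h x
  simp only at hx
  rw [norm_inv, hx] at h1
  have h2 : m ≤ 1 / (2 * K) := min_le_right _ _
  have h3 : 2 * K ≤ m⁻¹ := by
    rw [le_inv_comm₀ (by positivity) hm0]; simpa using h2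
  linarith

/-! ### The scaling zeta function -/

/-- Where `∑_j r_j^(Re s) < 1`, the sum over words is a geometric series. The normal form comes for
free, as `0⁻¹ = 0` is the value prescribed at a pole. -/
lemma isMeromorphicExtension_inv_denom :
    IsMeromorphicExtension (fun s => ∑' w : List (Fin J), (S.wordRatio w : ℂ) ^ s)
      (fun s => (S.denom s)⁻¹) := by
  constructor
  · exact meromorphicNFOn_inv.2 S.analyticOnNhd_denom.meromorphicNFOn
  · obtain ⟨σ₁, hσ₁⟩ := (S.tendsto_moran_atTop.eventually (gt_mem_nhds one_pos)).exists
    exact ⟨σ₁, fun s hs => (S.hasSum_wordRatio_cpow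
      ((S.moran_antitone hs.le).trans_lt hσ₁)).tsum_eq.symm⟩

end SelfSimilarSystem

/-- The difference vanishes to infinite order at a point of the common half-plane, hence everywhere
by connectedness; normal form upgrades agreement on punctured neighbourhoods to agreement at the
centre. -/
lemma IsMeromorphicExtension.eq {f F₁ F₂ : ℂ → ℂ} (h₁ : IsMeromorphicExtension f F₁)
    (h₂ : IsMeromorphicExtension f F₂) : F₁ = F₂ := by
  obtain ⟨hn₁, σ₁, hs₁⟩ := h₁
  obtain ⟨hn₂, σ₂, hs₂⟩ := h₂
  have hm₁ : MeromorphicOn F₁ univ := hn₁.meromorphicOn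
  have hm₂ : MeromorphicOn F₂ univ := hn₂.meromorphicOn
  have hm : MeromorphicOn (F₁ - F₂) univ := hm₁.sub hm₂
  have hx : meromorphicOrderAt (F₁ - F₂) ((max σ₁ σ₂ + 1 : ℝ) : ℂ) = ⊤ := by
    rw [meromorphicOrderAt_eq_top_iff]
    refine Filter.Eventually.filter_mono nhdsWithin_le_nhds ?_
    have : ∀ᶠ s : ℂ in 𝓝 ((max σ₁ σ₂ + 1 : ℝ) : ℂ), max σ₁ σ₂ < s.re := by
      refine Complex.continuous_re.continuousAt.eventually (lt_mem_nhds ?_)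
      simp
    filter_upwards [this] with s hs
    simp [hs₁ s ((le_max_left _ _).trans_lt hs), hs₂ s ((le_max_right _ _).trans_lt hs)]
  ext z
  have hz : meromorphicOrderAt (F₁ - F₂) z = ⊤ := by
    by_contra hne
    exact hm.meromorphicOrderAt_ne_top_of_isPreconnected isPreconnected_univ (mem_univ z)
      (mem_univ _) hne hx
  rw [meromorphicOrderAt_eq_top_iff] at hz
  have he : F₁ =ᶠ[𝓝[≠] z] F₂ := hz.mono fun s hs => sub_eq_zero.1 hs
  exact ((hn₁ (mem_univ z)).eventuallyEq_nhdsNE_iff_eventuallyEq_nhds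
    (hn₂ (mem_univ z))|>.1 he).eq_of_nhds

lemma meromorphicExtension_eq {f F : ℂ → ℂ} (h : IsMeromorphicExtension f F) :
    meromorphicExtension f = F :=
  (Classical.epsilon_spec (⟨F, h⟩ : ∃ F, IsMeromorphicExtension f F)).eq h

namespace SelfSimilarSystem

variable {d J : ℕ} (S : SelfSimilarSystem d J)

lemma scalingZeta_eq : S.scalingZeta = fun s => (S.denom s)⁻¹ :=
  meromorphicExtension_eq S.isMeromorphicExtension_inv_denom

/-! ### Poles and residues of the scaling zeta function -/

lemma analyticOrderAt_denom_ne_top (z : ℂ) : analyticOrderAt S.denom z ≠ ⊤ := by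
  intro h
  obtain ⟨s, hs⟩ := S.exists_denom_ne_zero
  exact hs (S.analyticOnNhd_denom.eqOn_zero_of_preconnected_of_eventuallyEq_zero
    isPreconnected_univ (mem_univ z) (analyticOrderAt_eq_top.1 h) (mem_univ s))

lemma meromorphicOrderAt_scalingZeta (z : ℂ) :
    meromorphicOrderAt S.scalingZeta z = ((-(analyticOrderNatAt S.denom z : ℤ) : ℤ) : WithTop ℤ) := by
  have : S.scalingZeta = S.denom⁻¹ := by rw [scalingZeta_eq]; rfl
  rw [this, meromorphicOrderAt_inv, (S.analyticOnNhd_denom z (mem_univ z)).meromorphicOrderAt_eq,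
    ← Nat.cast_analyticOrderNatAt (S.analyticOrderAt_denom_ne_top z)]
  rfl

lemma scalingDims_eq : S.scalingDims = {z | S.denom z = 0} := by
  ext z
  rw [scalingDims, poles, mem_ofPred_eq, mem_ofPred_eq, meromorphicOrderAt_scalingZeta]
  have h1 : analyticOrderAt S.denom z ≠ 0 ↔ S.denom z = 0 :=
    (S.analyticOnNhd_denom z (mem_univ z)).analyticOrderAt_ne_zero
  rw [← Nat.cast_analyticOrderNatAt (S.analyticOrderAt_denom_ne_top z)] at h1
  rw [← h1, ← WithTop.coe_zero, WithTop.coe_lt_coe]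
  simp [Nat.pos_iff_ne_zero]

lemma deriv_denom_ne_zero (h : HasOnlySimplePoles S.scalingZeta) {z : ℂ} (hz : S.denom z = 0) :
    deriv S.denom z ≠ 0 := by
  have hmem : z ∈ S.scalingDims := by rw [scalingDims_eq]; exact hz
  have h1 := h z hmem
  rw [meromorphicOrderAt_scalingZeta, WithTop.coe_eq_coe] at h1
  have h2 : analyticOrderAt S.denom z = 1 := by
    rw [← Nat.cast_analyticOrderNatAt (S.analyticOrderAt_denom_ne_top z)]
    have : analyticOrderNatAt S.denom z = 1 := by omega
    rw [this]; rfl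
  intro h0
  have ha := S.analyticOnNhd_denom z (mem_univ z)
  have hd : Differentiable ℂ (dslope S.denom z) := entire_dslope S.differentiable_denom z
  -- If the derivative vanished too, `(s - z)` could be divided out twice, contradicting order one.
  have h3 := (natCast_le_analyticOrderAt ha (n := 2)).2
    ⟨dslope (dslope S.denom z) z, (entire_dslope hd z).analyticAt z, .of_forall fun s => by
      rw [eq_sub_mul_dslope hz s, eq_sub_mul_dslope (by rw [dslope_same, h0] :
        dslope S.denom z z = 0) s, smul_eq_mul]; ring⟩
  rw [h2] at h3
  exact absurd h3 (by decide)

lemma finite_truncated (T : ℤ → ℝ) (n : ℕ) : (truncated S.scalingDims T n).Finite := by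
  refine (S.finite_zeros (T (-n)) (T n)).subset fun s hs => ?_
  rw [scalingDims_eq] at hs
  exact ⟨hs.1, hs.2.1.le, hs.2.2.le⟩

lemma residue_scalingZeta (h : HasOnlySimplePoles S.scalingZeta) {z : ℂ} (hz : S.denom z = 0) :
    residue S.scalingZeta z = (deriv S.denom z)⁻¹ := by
  rw [scalingZeta_eq]
  exact residue_inv S.differentiable_denom hz (S.deriv_denom_ne_zero h hz)

/-- At such a `k` both `ζ_s` and the `k`-th term of `generatorSum` would have a simple pole if `κ k
≠ 0`, and the tubular zeta function a double one. This also makes the terms with division by zero in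
the formula harmless. -/
lemma coeff_eq_zero_of_pole {G : Set (E d)} {κ : ℕ → ℝ} (hg : 0 < inradius G)
    (hζT : ∀ ε : ℝ, 0 < ε → HasOnlySimplePoles (S.tubularZeta G κ ε))
    (hζs : HasOnlySimplePoles S.scalingZeta) {k : ℕ} (hk : k ≤ d) (hz : S.denom k = 0) :
    κ k = 0 := by
  classical
  by_contra hκ
  set g := inradius G
  have hgc : (g : ℂ) ≠ 0 := by exact_mod_cast hg.ne'
  set D := dslope S.denom (k : ℂ)
  have hDd : Differentiable ℂ D := entire_dslope S.differentiable_denom _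
  have hDk : D k ≠ 0 := by
    rw [show D k = _ from dslope_same _ _]; exact S.deriv_denom_ne_zero hζs hz
  set R : ℂ → ℂ := fun s => ∑ i ∈ (Finset.range (d + 1)).erase k, (g : ℂ) ^ (s - i) / (s - i) * κ i
  set N : ℂ → ℂ := fun s => (D s)⁻¹ * ((g : ℂ) ^ (s - k) * κ k + (s - k) * R s)
  have hpow : ∀ i : ℕ, AnalyticAt ℂ (fun s : ℂ => (g : ℂ) ^ (s - i)) k := by
    intro i
    refine Differentiable.analyticAt (fun s => ?_) _
    exact (differentiableAt_id.sub_const _).const_cpow (Or.inl hgc)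
  have hsub : ∀ i : ℕ, AnalyticAt ℂ (fun s : ℂ => s - i) k := fun i =>
    analyticAt_id.sub analyticAt_const
  have hR : AnalyticAt ℂ R k := by
    refine Finset.analyticAt_fun_sum _ fun i hi => ?_
    refine ((hpow i).div (hsub i) ?_).mul analyticAt_const
    rw [sub_ne_zero]
    exact_mod_cast (Finset.ne_of_mem_erase hi).symm
  have hN : AnalyticAt ℂ N k :=
    ((hDd.analyticAt _).inv hDk).mul (((hpow k).mul analyticAt_const).add ((hsub k).mul hR))
  have hNk : N k ≠ 0 := by
    simp [N, hDk, hκ]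
  -- Any `ε > 0` would do; at `ε = 1` the factor `ε ^ (d - s)` is constant.
  have hord : meromorphicOrderAt (S.tubularZeta G κ 1) k = (-2 : ℤ) := by
    have hev : S.tubularZeta G κ 1 =ᶠ[𝓝[≠] (k : ℂ)] fun s => (s - k) ^ (-2 : ℤ) • N s := by
      filter_upwards [self_mem_nhdsWithin] with s hs
      have hs' : s - k ≠ 0 := sub_ne_zero.2 hs
      have h1 : generatorSum G κ s = (s - k)⁻¹ * ((g : ℂ) ^ (s - k) * κ k + (s - k) * R s) := by
        rw [generatorSum, ← Finset.add_sum_erase _ _ (Finset.mem_range.2 (Nat.lt_succ_of_le hk))]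
        have h2 : ∑ i ∈ (Finset.range d.succ).erase k,
            (inradius G : ℂ) ^ (s - i) / (s - i) * κ i = R s := rfl
        rw [h2]
        field_simp
        rw [mul_comm (κ k : ℂ)]
      rw [tubularZeta, h1, scalingZeta_eq]
      simp only [Complex.ofReal_one, Complex.one_cpow, one_mul, smul_eq_mul, N]
      rw [eq_sub_mul_dslope hz s, mul_inv]
      have : (s - (k : ℂ)) ^ (-2 : ℤ) = (s - k)⁻¹ * (s - k)⁻¹ := by
        rw [zpow_neg, ← mul_inv]; congr 1; exact zpow_two _
      rw [this]
      ring
    rw [meromorphicOrderAt_congr hev]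
    refine (meromorphicOrderAt_eq_int_iff ?_).2 ⟨N, hN, hNk, .of_forall fun _ => rfl⟩
    exact ((hsub k).meromorphicAt.zpow _).smul hN.meromorphicAt
  have := hζT 1 one_pos k (by rw [poles, mem_ofPred_eq, hord]; decide)
  rw [hord] at this
  exact absurd this (by decide)

end SelfSimilarSystem

/-! ### Existence of languid sequences -/

/-- In the compact group `Circle ^ n` the powers of any element return arbitrarily close to `1`. -/
lemma exists_pow_near_one {n : ℕ} (x : Fin n → Circle) {η : ℝ} (hη : 0 < η) (N : ℕ) :
    ∃ m ≥ N, ∀ j, ‖((x j : ℂ)) ^ m - 1‖ < η := by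
  have h := (mapClusterPt_one_atTop_pow x).frequently (Metric.ball_mem_nhds 1 hη)
  obtain ⟨m, hm, hx⟩ := Filter.frequently_atTop.1 h N
  refine ⟨m, hm, fun j => ?_⟩
  have h1 : dist (x ^ m) 1 < η := hx
  have h2 := (dist_le_pi_dist (x ^ m) 1 j).trans_lt h1
  have h3 : dist (((x ^ m) j : Circle) : ℂ) ((1 : Circle) : ℂ) < η := h2
  rw [dist_eq_norm] at h3
  simpa using h3

namespace SelfSimilarSystem

variable {d J : ℕ} (S : SelfSimilarSystem d J)

/-- The heights are `t₀ + n`, where the line `Im s = t₀` carries no zero and all `r_j^(i n)` are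
close to `1`, so that `denom` hardly changes under the shift by `i n`. Only a bounded range of `σ`
needs this; outside it `denom` is bounded below at every height. -/
lemma exists_heights : ∃ δ : ℝ, 0 < δ ∧ ∀ N : ℕ, ∃ t : ℝ, (N : ℝ) ≤ t ∧ 0 < t ∧
    ∀ σ : ℝ, δ ≤ ‖S.denom (σ + t * Complex.I)‖ := by
  obtain ⟨j₀, hj₀⟩ := S.exists_min_ratio
  obtain ⟨σ₀, hσ₀, hl⟩ := S.exists_le_norm_denom hj₀
  obtain ⟨σ₁, hσ₁, hσ₁0⟩ := ((S.tendsto_moran_atTop.eventually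
    (gt_mem_nhds (show (0 : ℝ) < 1 / 2 by norm_num))).and (eventually_ge_atTop 0)).exists
  -- Only finitely many heights in `[0, 1]` carry a zero.
  obtain ⟨t₀, ht₀, ht₀z⟩ : ∃ t₀ ∈ Ioo (0 : ℝ) 1, ∀ σ : ℝ, S.denom (σ + t₀ * Complex.I) ≠ 0 := by
    obtain ⟨t₀, ht, hn⟩ := ((Ioo_infinite (show (0 : ℝ) < 1 by norm_num)).sdiff
      ((S.finite_zeros 0 1).image Complex.im)).nonempty
    refine ⟨t₀, ht, fun σ h0 => hn ⟨_, ⟨h0, ?_⟩, by simp⟩⟩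
    simpa using Ioo_subset_Icc_self ht
  have hcont : ContinuousOn (fun x : ℝ => ‖S.denom (x + t₀ * Complex.I)‖) (Icc σ₀ σ₁) :=
    ((S.differentiable_denom.continuous.comp (by fun_prop)).norm).continuousOn
  obtain ⟨x₀, -, hx₀⟩ := isCompact_Icc.exists_isMinOn
    (nonempty_Icc.2 (hσ₀.trans hσ₁0)) hcont
  set m := ‖S.denom (x₀ + t₀ * Complex.I)‖ with hm
  have hm0 : 0 < m := norm_pos_iff.2 (ht₀z x₀)
  refine ⟨min (1 / 2) (m / 2), by positivity, fun N => ?_⟩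
  have hP : 0 ≤ S.moran σ₀ := S.moran_nonneg σ₀
  -- Chosen so that the shift changes `denom` by at most `m / 2` for `σ ≥ σ₀`; the `+ 1` keeps the
  -- quotient well defined.
  set η := m / (2 * (S.moran σ₀ + 1)) with hη
  have hη0 : 0 < η := by positivity
  obtain ⟨n, hn, hnear⟩ := exists_pow_near_one
    (fun j => Circle.exp (Real.log (S.ratio j))) hη0 N
  refine ⟨t₀ + n, ?_, by linarith [ht₀.1, (Nat.cast_nonneg n : (0 : ℝ) ≤ n)], fun σ => ?_⟩
  · have : (N : ℝ) ≤ n := by exact_mod_cast hn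
    linarith [ht₀.1]
  have hmulcpow : ∀ j, (S.ratio j : ℂ) ^ ((σ : ℂ) + ((t₀ + n : ℝ) : ℂ) * Complex.I) =
      (S.ratio j : ℂ) ^ ((σ : ℂ) + t₀ * Complex.I) *
        ((Circle.exp (Real.log (S.ratio j)) : ℂ)) ^ n := by
    intro j
    have hne : (S.ratio j : ℂ) ≠ 0 := by exact_mod_cast (S.ratio_pos j).ne'
    have : (σ : ℂ) + ((t₀ + n : ℝ) : ℂ) * Complex.I =
        ((σ : ℂ) + t₀ * Complex.I) + n * Complex.I := by push_cast; ring
    rw [this, Complex.cpow_add _ _ hne]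
    congr 1
    rw [Complex.cpow_def_of_ne_zero hne, Circle.coe_exp, ← Complex.exp_nat_mul,
      Complex.ofReal_log (S.ratio_pos j).le]
    congr 1
    ring
  rcases le_total σ σ₀ with h | h
  · refine (min_le_left _ _).trans ?_
    have := hl ((σ : ℂ) + ((t₀ + n : ℝ) : ℂ) * Complex.I) (by simpa using h)
    have h1 : (1 : ℝ) ≤ S.ratio j₀ ^ σ := by
      refine Real.one_le_rpow_of_pos_of_le_one_of_nonpos (S.ratio_pos j₀) (S.ratio_lt_one j₀).le ?_
      linarith
    have h2 : ((σ : ℂ) + ((t₀ + n : ℝ) : ℂ) * Complex.I).re = σ := by simp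
    rw [h2] at this
    linarith
  rcases le_total σ₁ σ with h' | h'
  · refine (min_le_left _ _).trans ?_
    have := S.one_sub_moran_le ((σ : ℂ) + ((t₀ + n : ℝ) : ℂ) * Complex.I)
    have h2 : ((σ : ℂ) + ((t₀ + n : ℝ) : ℂ) * Complex.I).re = σ := by simp
    rw [h2] at this
    linarith [S.moran_antitone h']
  · refine (min_le_right _ _).trans ?_
    have h1 : m ≤ ‖S.denom (σ + t₀ * Complex.I)‖ := hx₀ ⟨h, h'⟩
    have h2 : ‖S.denom (σ + t₀ * Complex.I) - S.denom ((σ : ℂ) + ((t₀ + n : ℝ) : ℂ) * Complex.I)‖ ≤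
        S.moran σ * η := by
      simp only [denom, hmulcpow, sub_sub_sub_cancel_left, ← Finset.sum_sub_distrib]
      refine (norm_sum_le _ _).trans ?_
      rw [moran, Finset.sum_mul]
      refine Finset.sum_le_sum fun j _ => ?_
      rw [← mul_sub_one, norm_mul, norm_ratio_cpow]
      simp only [Complex.add_re, Complex.ofReal_re, Complex.mul_re, Complex.I_re, mul_zero,
        Complex.ofReal_im, Complex.I_im, mul_one, sub_self, add_zero]
      exact mul_le_mul_of_nonneg_left (hnear j).le (Real.rpow_pos_of_pos (S.ratio_pos j) _).le
    have h3 : S.moran σ * η ≤ m / 2 := by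
      have : S.moran σ ≤ S.moran σ₀ + 1 := by linarith [S.moran_antitone h]
      calc S.moran σ * η ≤ (S.moran σ₀ + 1) * η := mul_le_mul_of_nonneg_right this hη0.le
        _ = m / 2 := by rw [hη]; field_simp
    have h4 := norm_sub_norm_le (S.denom (σ + t₀ * Complex.I))
      (S.denom ((σ : ℂ) + ((t₀ + n : ℝ) : ℂ) * Complex.I))
    linarith

lemma denom_conj (s : ℂ) : S.denom ((starRingEnd ℂ) s) = (starRingEnd ℂ) (S.denom s) := by
  simp only [denom, map_sub, map_one, map_sum]
  congr 1
  refine Finset.sum_congr rfl fun j _ => ?_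
  rw [Complex.cpow_conj _ _ (by
    rw [Complex.arg_ofReal_of_nonneg (S.ratio_pos j).le]; exact Real.pi_pos.ne), Complex.conj_ofReal]

lemma exists_isLanguidSequence : ∃ T : ℤ → ℝ, IsLanguidSequence S.scalingZeta T := by
  obtain ⟨δ, hδ, hh⟩ := S.exists_heights
  choose u hu hu0 hub using hh
  have hnot : ∀ n : ℕ, 1 ≤ n → ¬ (0 : ℤ) ≤ -(n : ℤ) := fun n hn => by omega
  have hpos : ∀ n : ℕ, (fun n : ℤ => if 0 ≤ n then u n.natAbs else -u n.natAbs) n = u n :=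
    fun n => by simp
  have hneg : ∀ n : ℕ, 1 ≤ n →
      (fun n : ℤ => if 0 ≤ n then u n.natAbs else -u n.natAbs) (-(n : ℤ)) = -u n := fun n hn => by
    simp only [hnot n hn, if_false, Int.natAbs_neg, Int.natAbs_natCast]
  have htop : Tendsto u atTop atTop := tendsto_atTop_mono hu tendsto_natCast_atTop_atTop
  -- Negative indices use reflected heights, for which `denom_conj` gives the same lower bound. The
  -- zeta function is even bounded on these lines; the exponent `1` only meets the requirement `0 <
  -- M`.
  refine ⟨fun n : ℤ => if 0 ≤ n then u n.natAbs else -u n.natAbs, fun n hn => ?_, ?_, ?_, ?_,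
    δ⁻¹, 1, by positivity, one_pos, fun n σ => ?_⟩
  · rw [hneg n hn, hpos n]
    exact ⟨by linarith [hu0 n], hu0 n⟩
  · exact htop.congr fun n => (hpos n).symm
  · refine (tendsto_neg_atTop_atBot.comp htop).congr' ?_
    filter_upwards [eventually_ge_atTop 1] with n hn using (hneg n hn).symm
  · refine tendsto_const_nhds.congr' ?_
    filter_upwards [eventually_ge_atTop 1] with n hn
    have h1 := hneg n hn
    have h2 := hpos n
    simp only at h1 h2
    rw [h1, h2, abs_neg, abs_of_pos (hu0 n), div_self (hu0 n).ne']
  · have hle : ∀ t : ℝ, δ ≤ ‖S.denom (σ + t * Complex.I)‖ →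
        ‖S.scalingZeta (σ + t * Complex.I)‖ ≤ δ⁻¹ * (|t| + 1) ^ (1 : ℝ) := by
      intro t ht
      rw [scalingZeta_eq, norm_inv, Real.rpow_one]
      have h1 : ‖S.denom (σ + t * Complex.I)‖⁻¹ ≤ δ⁻¹ := inv_anti₀ hδ ht
      have h2 : 0 < δ⁻¹ := by positivity
      nlinarith [abs_nonneg t]
    refine hle _ ?_
    by_cases h0 : 0 ≤ n
    · simp only [h0, if_true]
      exact hub _ σ
    · simp only [h0, if_false]
      have : (σ : ℂ) + ((-u n.natAbs : ℝ) : ℂ) * Complex.I =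
          (starRingEnd ℂ) (σ + u n.natAbs * Complex.I) := by simp
      rw [this, denom_conj, RCLike.norm_conj]
      exact hub _ σ

end SelfSimilarSystem

/-! ### Similitudes and inner neighbourhoods -/

/-- The similitude `x ↦ r • M x + b` as a homeomorphism. -/
noncomputable def similitude {d : ℕ} (r : ℝ) (hr : 0 < r) (M : E d ≃ₗᵢ[ℝ] E d) (b : E d) :
    E d ≃ₜ E d :=
  (M.toHomeomorph.trans (Homeomorph.smulOfNeZero r hr.ne')).trans (Homeomorph.addRight b)

lemma similitude_apply {d : ℕ} {r : ℝ} (hr : 0 < r) (M : E d ≃ₗᵢ[ℝ] E d) (b x : E d) :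
    similitude r hr M b x = r • M x + b := rfl

open scoped Pointwise in
lemma similitude_image {d : ℕ} {r : ℝ} (hr : 0 < r) (M : E d ≃ₗᵢ[ℝ] E d) (b : E d)
    (A : Set (E d)) : similitude r hr M b '' A = (fun x => x + b) '' (r • (M '' A)) := by
  rw [← image_smul, image_image, image_image]
  rfl

lemma volume_similitude_image {d : ℕ} {r : ℝ} (hr : 0 < r) (M : E d ≃ₗᵢ[ℝ] E d) (b : E d)
    {A : Set (E d)} (hA : MeasurableSet A) :
    volume (similitude r hr M b '' A) = ENNReal.ofReal (r ^ d) * volume A := by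
  rw [similitude_image, image_add_right, measure_preimage_add_right, Measure.addHaar_smul,
    finrank_euclideanSpace_fin, abs_of_pos (pow_pos hr d)]
  congr 1
  have : M '' A = M.symm ⁻¹' A := by
    ext x
    constructor
    · rintro ⟨y, hy, rfl⟩
      simpa using hy
    · exact fun hx => ⟨M.symm x, hx, by simp⟩
  rw [this, M.symm.measurePreserving.measure_preimage hA.nullMeasurableSet]

lemma infDist_similitude {d : ℕ} {r : ℝ} (hr : 0 < r) (M : E d ≃ₗᵢ[ℝ] E d) (b x : E d)
    (A : Set (E d)) :
    Metric.infDist (similitude r hr M b x) (similitude r hr M b '' A) = r * Metric.infDist x A := by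
  rw [similitude_image, similitude_apply,
    Metric.infDist_image (Φ := fun y => y + b) (isometry_add_right b), infDist_smul₀ hr.ne',
    Metric.infDist_image M.isometry, Real.norm_of_nonneg hr.le]

lemma innerNhd_similitude {d : ℕ} {r : ℝ} (hr : 0 < r) (M : E d ≃ₗᵢ[ℝ] E d) (b : E d)
    (A : Set (E d)) (ε : ℝ) :
    innerNhd (similitude r hr M b '' A) ε = similitude r hr M b '' innerNhd A (ε / r) := by
  ext y
  constructor
  · rintro ⟨⟨x, hx, rfl⟩, h⟩
    refine ⟨x, ⟨hx, ?_⟩, rfl⟩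
    rw [← Homeomorph.image_frontier, infDist_similitude] at h
    rw [le_div_iff₀ hr, mul_comm]
    exact h
  · rintro ⟨x, ⟨hx, h⟩, rfl⟩
    refine ⟨⟨x, hx, rfl⟩, ?_⟩
    rw [← Homeomorph.image_frontier, infDist_similitude, mul_comm]
    exact (le_div_iff₀ hr).1 h

lemma measurableSet_innerNhd {d : ℕ} {A : Set (E d)} (hA : MeasurableSet A) (ε : ℝ) :
    MeasurableSet (innerNhd A ε) :=
  hA.inter (isClosed_le (Metric.continuous_infDist_pt _) continuous_const).measurableSet

lemma innerNhd_subset {d : ℕ} (A : Set (E d)) (ε : ℝ) : innerNhd A ε ⊆ A := fun _ h => h.1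

lemma volume_innerNhd_ne_top {d : ℕ} {A : Set (E d)} (hA : Bornology.IsBounded A) (ε : ℝ) :
    volume (innerNhd A ε) ≠ ⊤ :=
  ((measure_mono (innerNhd_subset A ε)).trans_lt hA.measure_lt_top).ne

lemma tubeVolume_mono {d : ℕ} {A : Set (E d)} (hA : Bornology.IsBounded A) :
    Monotone (tubeVolume A) := fun _ _ h =>
  ENNReal.toReal_mono (volume_innerNhd_ne_top hA _)
    (measure_mono fun _ hx => ⟨hx.1, hx.2.trans h⟩)

lemma tubeVolume_nonneg {d : ℕ} (A : Set (E d)) (ε : ℝ) : 0 ≤ tubeVolume A ε :=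
  ENNReal.toReal_nonneg

/-! ### Distance to the boundary of a disjoint union of open sets -/

/-- The segment from `x` to `p` is connected, so it meets the frontier. -/
lemma exists_frontier_dist_le {d : ℕ} {A : Set (E d)} {x p : E d} (hx : x ∈ A) (hp : p ∉ A) :
    ∃ q ∈ frontier A, dist x q ≤ dist x p := by
  obtain ⟨q, hq, hqf⟩ : ∃ q ∈ segment ℝ x p, q ∈ frontier A := by
    by_contra! hno
    have hx' : x ∈ interior A := by
      by_contra h
      exact hno x (left_mem_segment ℝ x p) ⟨subset_closure hx, h⟩
    have hp' : p ∉ closure A := fun h =>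
      hno p (right_mem_segment ℝ x p) ⟨h, fun h' => hp (interior_subset h')⟩
    obtain ⟨q, -, hq1, hq2⟩ := (convex_segment (𝕜 := ℝ) x p).isPreconnected (interior A)
      (closure A)ᶜ isOpen_interior isClosed_closure.isOpen_compl
      (fun q hq => or_iff_not_imp_right.2 fun h => by
        by_contra h'
        exact hno q hq ⟨not_not.1 h, h'⟩)
      ⟨x, left_mem_segment ℝ x p, hx'⟩ ⟨p, right_mem_segment ℝ x p, hp'⟩
    exact hq2 (interior_subset_closure hq1)
  refine ⟨q, hqf, ?_⟩
  have := dist_add_dist_of_mem_segment hq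
  linarith [dist_nonneg (x := q) (y := p)]

lemma infDist_frontier_le {d : ℕ} {A : Set (E d)} {x p : E d} (hx : x ∈ A) (hp : p ∉ A) :
    Metric.infDist x (frontier A) ≤ dist x p := by
  obtain ⟨q, hq, h⟩ := exists_frontier_dist_le hx hp
  exact (Metric.infDist_le_dist_of_mem hq).trans h

lemma ball_infDist_frontier_subset {d : ℕ} {A : Set (E d)} {x : E d} (hx : x ∈ A) :
    Metric.ball x (Metric.infDist x (frontier A)) ⊆ A := by
  intro p hp
  by_contra h
  rw [Metric.mem_ball'] at hp
  exact absurd (infDist_frontier_le hx h) (not_le.2 hp)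

lemma frontier_nonempty_of_isBounded {d : ℕ} [Nontrivial (E d)] {A : Set (E d)}
    (hA : Bornology.IsBounded A) (hne : A.Nonempty) : (frontier A).Nonempty := by
  rw [nonempty_iff_ne_empty]
  intro h
  rcases frontier_eq_empty_iff.1 h with h | h
  · exact hne.ne_empty h
  · rw [h] at hA
    exact NormedSpace.unbounded_univ ℝ (E d) hA

/-- A frontier point of `A i` lies in no other open `A j`, so it is a frontier point of the union.
Conversely, a frontier point of the union is outside `A i`, and the segment to it from `x` crosses
the frontier of `A i`. Boundedness and positive dimension keep both frontiers nonempty, as `infDist`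
to the empty set is `0`. -/
lemma infDist_frontier_iUnion {d : ℕ} [Nontrivial (E d)] {ι : Type*} {A : ι → Set (E d)}
    (hopen : ∀ i, IsOpen (A i)) (hdisj : Pairwise fun i j => Disjoint (A i) (A j))
    (hb : Bornology.IsBounded (⋃ i, A i)) {i : ι} {x : E d} (hx : x ∈ A i) :
    Metric.infDist x (frontier (⋃ i, A i)) = Metric.infDist x (frontier (A i)) := by
  have hsub : A i ⊆ ⋃ i, A i := subset_iUnion A i
  have hUo : IsOpen (⋃ i, A i) := isOpen_iUnion hopen
  have hfr : frontier (A i) ⊆ frontier (⋃ i, A i) := by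
    intro p hp
    rw [(hopen i).frontier_eq] at hp
    rw [hUo.frontier_eq]
    refine ⟨closure_mono hsub hp.1, fun hpU => ?_⟩
    obtain ⟨j, hj⟩ := mem_iUnion.1 hpU
    by_cases hij : i = j
    · subst hij
      exact hp.2 hj
    · have := (hdisj hij).closure_left (hopen j)
      exact this.le_bot ⟨hp.1, hj⟩
  refine le_antisymm (Metric.infDist_le_infDist_of_subset hfr
    (frontier_nonempty_of_isBounded (hb.subset hsub) ⟨x, hx⟩)) ?_
  refine (Metric.le_infDist (frontier_nonempty_of_isBounded hb ⟨x, hsub hx⟩)).2 fun p hp => ?_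
  rw [hUo.frontier_eq] at hp
  exact infDist_frontier_le hx fun h => hp.2 (hsub h)

lemma innerNhd_iUnion {d : ℕ} [Nontrivial (E d)] {ι : Type*} {A : ι → Set (E d)}
    (hopen : ∀ i, IsOpen (A i)) (hdisj : Pairwise fun i j => Disjoint (A i) (A j))
    (hb : Bornology.IsBounded (⋃ i, A i)) (ε : ℝ) :
    innerNhd (⋃ i, A i) ε = ⋃ i, innerNhd (A i) ε := by
  ext x
  simp only [innerNhd, mem_iUnion, mem_ofPred_eq]
  constructor
  · rintro ⟨⟨i, hi⟩, h⟩
    exact ⟨i, hi, by rwa [infDist_frontier_iUnion hopen hdisj hb hi] at h⟩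
  · rintro ⟨i, hi, h⟩
    exact ⟨⟨i, hi⟩, by rwa [infDist_frontier_iUnion hopen hdisj hb hi]⟩

lemma hasSum_tubeVolume_iUnion {d : ℕ} [Nontrivial (E d)] {ι : Type*} [Countable ι]
    {A : ι → Set (E d)} (hopen : ∀ i, IsOpen (A i))
    (hdisj : Pairwise fun i j => Disjoint (A i) (A j))
    (hb : Bornology.IsBounded (⋃ i, A i)) (ε : ℝ) :
    HasSum (fun i => tubeVolume (A i) ε) (tubeVolume (⋃ i, A i) ε) := by
  have h1 : volume (innerNhd (⋃ i, A i) ε) = ∑' i, volume (innerNhd (A i) ε) := by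
    rw [innerNhd_iUnion hopen hdisj hb, measure_iUnion]
    · exact fun i j hij => (hdisj hij).mono (innerNhd_subset _ _) (innerNhd_subset _ _)
    · exact fun i => measurableSet_innerNhd (hopen i).measurableSet ε
  have h2 : ∑' i, volume (innerNhd (A i) ε) ≠ ⊤ := h1 ▸ volume_innerNhd_ne_top hb ε
  have := ENNReal.hasSum_toReal h2
  rw [← ENNReal.tsum_toReal_eq (fun i => volume_innerNhd_ne_top (hb.subset (subset_iUnion A i)) ε),
    ← h1] at this
  exact this

lemma tubeVolume_similitude {d : ℕ} {r : ℝ} (hr : 0 < r) (M : E d ≃ₗᵢ[ℝ] E d) (b : E d)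
    {A : Set (E d)} (hA : MeasurableSet A) (ε : ℝ) :
    tubeVolume (similitude r hr M b '' A) ε = r ^ d * tubeVolume A (ε / r) := by
  rw [tubeVolume, measureReal_def, innerNhd_similitude,
    volume_similitude_image hr M b (measurableSet_innerNhd hA _), ENNReal.toReal_mul,
    ENNReal.toReal_ofReal (pow_pos hr d).le]
  rfl

/-! ### The inradius -/

lemma bddAbove_inradius_set {d : ℕ} [Nontrivial (E d)] {A : Set (E d)}
    (hA : Bornology.IsBounded A) : BddAbove {ε : ℝ | 0 < ε ∧ ∃ x, Metric.ball x ε ⊆ A} := by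
  refine ⟨2 * Metric.diam A, ?_⟩
  rintro ε ⟨hε, x, hx⟩
  obtain ⟨v, hv⟩ := exists_norm_eq (E d) (c := ε / 2) (by linarith)
  have := Metric.dist_le_diam_of_mem hA (hx (show x + v ∈ _ by simp [hv, hε]))
    (hx (Metric.mem_ball_self hε))
  rw [dist_eq_norm, add_sub_cancel_left, hv] at this
  linarith

/-- The ball around `x ∈ A` with radius the distance to the frontier stays inside `A`, so no point
of `A` is deeper than the inradius. -/
lemma tubeVolume_eq_volume {d : ℕ} [Nontrivial (E d)] {A : Set (E d)} (hA : Bornology.IsBounded A)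
    {ε : ℝ} (hg : 0 < inradius A) (hε : inradius A ≤ ε) : tubeVolume A ε = volume.real A := by
  rw [tubeVolume]
  congr 1
  refine (innerNhd_subset A ε).antisymm fun x hx => ⟨hx, ?_⟩
  rcases le_or_gt (Metric.infDist x (frontier A)) 0 with h | h
  · exact h.trans (hg.le.trans hε)
  · exact (le_csSup (bddAbove_inradius_set hA) ⟨h, x, ball_infDist_frontier_subset hx⟩).trans hε

lemma exists_ball_subset_of_inradius_pos {d : ℕ} {A : Set (E d)} (hg : 0 < inradius A) :
    ∃ ε : ℝ, 0 < ε ∧ ∃ x, Metric.ball x ε ⊆ A := by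
  by_contra h
  have : {ε : ℝ | 0 < ε ∧ ∃ x, Metric.ball x ε ⊆ A} = ∅ :=
    eq_empty_of_forall_notMem fun ε hε => h ⟨ε, hε⟩
  rw [inradius, this, Real.sSup_empty] at hg
  exact lt_irrefl _ hg

/-- In dimension `0` the one-point space contains balls of every radius, and the supremum of this
unbounded set is `0` by convention. -/
lemma nontrivial_of_inradius_pos {d : ℕ} {A : Set (E d)} (hg : 0 < inradius A) :
    Nontrivial (E d) := by
  by_contra h
  rw [not_nontrivial_iff_subsingleton] at h
  obtain ⟨ε, hε, x, hx⟩ := exists_ball_subset_of_inradius_pos hg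
  have hA : A = univ := eq_univ_of_forall fun y => by
    rw [Subsingleton.elim y x]; exact hx (Metric.mem_ball_self hε)
  have hbdd : ¬ BddAbove {ε : ℝ | 0 < ε ∧ ∃ x, Metric.ball x ε ⊆ A} := by
    rintro ⟨b, hb⟩
    have := hb (show |b| + 1 ∈ _ from ⟨by positivity, x, by simp [hA]⟩)
    linarith [le_abs_self b]
  rw [inradius, Real.sSup_of_not_bddAbove hbdd] at hg
  exact lt_irrefl _ hg

/-! ### Convex hulls and relative interiors -/

/-- By Carathéodory the hull is a finite union of continuous images of products of a simplex with
copies of `K`, with at most `d + 1` points in each combination. -/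
lemma isCompact_convexHull_of_isCompact {d : ℕ} {K : Set (E d)} (hK : IsCompact K) :
    IsCompact (convexHull ℝ K) := by
  have heq : convexHull ℝ K = ⋃ n ∈ Finset.range (d + 2),
      (fun p : (Fin n → ℝ) × (Fin n → E d) => ∑ i, p.1 i • p.2 i) ''
        (stdSimplex ℝ (Fin n) ×ˢ Set.pi univ fun _ => K) := by
    apply Subset.antisymm
    · intro x hx
      obtain ⟨ι, hι, z, w, hz, hind, hw, hw1, hwz⟩ := eq_pos_convex_span_of_mem_convexHull hx
      have hcard : Fintype.card ι ≤ d + 1 := by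
        have h1 := hind.card_le_finrank_succ
        have h2 := Submodule.finrank_le (vectorSpan ℝ (range z))
        rw [finrank_euclideanSpace_fin] at h2
        omega
      let e := Fintype.equivFin ι
      simp only [mem_iUnion]
      refine ⟨Fintype.card ι, Finset.mem_range.2 (by omega), (w ∘ e.symm, z ∘ e.symm),
        ⟨⟨fun i => (hw _).le, ?_⟩, fun i _ => hz ⟨_, rfl⟩⟩, ?_⟩
      · rw [← hw1]; exact e.symm.sum_comp w
      · rw [← hwz]; exact e.symm.sum_comp fun i => w i • z i
    · refine iUnion₂_subset fun n _ => ?_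
      rintro _ ⟨p, ⟨⟨h0, h1⟩, hp⟩, rfl⟩
      exact (convex_convexHull ℝ K).sum_mem (fun i _ => h0 i) h1
        fun i _ => subset_convexHull ℝ K (hp i (mem_univ i))
  rw [heq]
  refine (Finset.finite_toSet _).isCompact_biUnion fun n _ => ?_
  refine ((isCompact_stdSimplex ℝ (Fin n)).prod (isCompact_univ_pi fun _ => hK)).image ?_
  fun_prop

lemma intrinsicInterior_eq_interior {d : ℕ} {A : Set (E d)} (h : affineSpan ℝ A = ⊤) :
    intrinsicInterior ℝ A = interior A := by
  refine Subset.antisymm ?_ interior_subset_intrinsicInterior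
  have hopen : IsOpen ((affineSpan ℝ A : AffineSubspace ℝ (E d)) : Set (E d)) := by
    rw [h]; exact isOpen_univ
  refine interior_maximal intrinsicInterior_subset ?_
  exact hopen.isOpenEmbedding_subtypeVal.isOpenMap _ isOpen_interior

namespace SelfSimilarSystem

variable {d J : ℕ} (S : SelfSimilarSystem d J)

/-! ### The tiles of a self-similar tiling -/

lemma sim_eq_similitude (j : Fin J) :
    S.sim j = similitude (S.ratio j) (S.ratio_pos j) (S.rot j) (S.shift j) := rfl

/-- The last letter is the outermost map; hence the later inductions remove letters from the end. -/
lemma wordSim_append_singleton (w : List (Fin J)) (j : Fin J) :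
    S.wordSim (w ++ [j]) = S.sim j ∘ S.wordSim w := by
  induction w with
  | nil => rfl
  | cons i w ih =>
    rw [List.cons_append, wordSim, ih, wordSim]
    rfl

lemma exists_wordSim_eq (w : List (Fin J)) : ∃ (M : E d ≃ₗᵢ[ℝ] E d) (b : E d),
    S.wordSim w = similitude (S.wordRatio w) (S.wordRatio_pos w) M b := by
  induction w with
  | nil =>
    refine ⟨LinearIsometryEquiv.refl ℝ _, 0, funext fun x => ?_⟩
    simp [similitude_apply, wordSim, wordRatio]
  | cons j w ih =>
    obtain ⟨M, b, h⟩ := ih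
    refine ⟨(S.rot j).trans M, S.wordRatio w • M (S.shift j) + b, funext fun x => ?_⟩
    simp only [wordSim, h, Function.comp_apply, sim, similitude_apply, map_add, map_smul, smul_add,
      LinearIsometryEquiv.trans_apply, wordRatio, List.map_cons, List.prod_cons, smul_smul]
    rw [mul_comm, add_assoc]

lemma sim_image_hull_subset {F : Set (E d)} (hF : S.IsAttractor F) (j : Fin J) :
    S.sim j '' convexHull ℝ F ⊆ convexHull ℝ F := by
  rw [image_subset_iff]
  refine convexHull_min ?_ ?_
  · intro x hx
    refine subset_convexHull ℝ F ?_
    rw [hF.2.2]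
    exact mem_iUnion.2 ⟨j, x, hx, rfl⟩
  · intro x hx y hy a b ha hb hab
    have : S.sim j (a • x + b • y) = a • S.sim j x + b • S.sim j y := by
      simp only [sim, map_add, map_smul, smul_add, smul_comm a, smul_comm b]
      have : S.shift j = a • S.shift j + b • S.shift j := by rw [← add_smul, hab, one_smul]
      conv_lhs => rw [this]
      abel
    rw [mem_preimage, this]
    exact convex_convexHull ℝ F hx hy ha hb hab

lemma sim_image_interior_subset (j : Fin J) (A : Set (E d)) :
    S.sim j '' interior A ⊆ interior (S.sim j '' A) := by
  rw [sim_eq_similitude, Homeomorph.image_interior]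

/-- What the tileset condition says about a single generator with positive inradius. -/
structure IsGenerator (F G : Set (E d)) : Prop where
  nontrivial : Nontrivial (E d)
  isOpen : IsOpen G
  subset : G ⊆ interior (convexHull ℝ F)
  disjoint : ∀ j, Disjoint G (S.sim j '' convexHull ℝ F)
  hull_disjoint : ∀ i j, i ≠ j → Disjoint (interior (S.sim i '' convexHull ℝ F))
    (interior (S.sim j '' convexHull ℝ F))
  maps : ∀ j, S.sim j '' convexHull ℝ F ⊆ convexHull ℝ F
  isCompact : IsCompact (convexHull ℝ F)
  nonempty : G.Nonempty

variable {S} in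
lemma isGenerator {F G : Set (E d)} (hF : S.IsAttractor F) (hT : S.TilesetCondition F)
    (hG : S.generators F = {G}) (hg : 0 < inradius G) : S.IsGenerator F G := by
  obtain ⟨ε, hε, x, hx⟩ := exists_ball_subset_of_inradius_pos hg
  -- With a single connected component, that component is the whole set.
  have hGT : G = S.tilesetOne F := by
    apply Subset.antisymm
    · have : G ∈ S.generators F := by rw [hG]; rfl
      obtain ⟨y, -, rfl⟩ := this
      exact connectedComponentIn_subset _ _
    · intro y hy
      have : connectedComponentIn (S.tilesetOne F) y ∈ S.generators F := ⟨y, hy, rfl⟩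
      rw [hG, mem_singleton_iff] at this
      rw [← this]
      exact mem_connectedComponentIn hy
  have hsub : G ⊆ tileset F := by rw [hGT]; exact sdiff_subset
  have hint : (interior (convexHull ℝ F)).Nonempty :=
    ⟨x, interior_maximal (hx.trans (hsub.trans intrinsicInterior_subset)) Metric.isOpen_ball
      (Metric.mem_ball_self hε)⟩
  -- A ball inside `G` makes the hull full-dimensional, so its relative interior is its interior and
  -- `G` is open in `ℝ^d`.
  have hspan : affineSpan ℝ (convexHull ℝ F) = ⊤ := by
    rw [affineSpan_convexHull]; exact affineSpan_eq_top_of_nonempty_interior hint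
  have htile : tileset F = interior (convexHull ℝ F) := intrinsicInterior_eq_interior hspan
  have hcomp : IsCompact (convexHull ℝ F) := isCompact_convexHull_of_isCompact hF.2.1
  have hdis : ∀ j, Disjoint G (S.sim j '' convexHull ℝ F) := by
    intro j
    rw [Set.disjoint_left]
    intro y hy hyj
    rw [hGT] at hy
    exact hy.2 (mem_iUnion.2 ⟨j, hyj⟩)
  refine ⟨nontrivial_of_inradius_pos hg, ?_, htile ▸ hsub, hdis, fun i j hij =>
    disjoint_iff_inter_eq_empty.2 (hT.2 i j hij), S.sim_image_hull_subset hF, hcomp,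
    ⟨x, hx (Metric.mem_ball_self hε)⟩⟩
  rw [hGT, tilesetOne, htile]
  refine isOpen_interior.sdiff ?_
  refine isClosed_iUnion_of_finite fun j => ?_
  rw [sim_eq_similitude]
  exact (hcomp.image (Homeomorph.continuous _)).isClosed

variable {S} {F G : Set (E d)}

namespace IsGenerator

lemma wordSim_image_subset (h : S.IsGenerator F G) (w : List (Fin J)) :
    S.wordSim w '' G ⊆ interior (convexHull ℝ F) := by
  induction w using List.reverseRecOn with
  | nil => simpa [wordSim] using h.subset
  | append_singleton w j ih =>
    rw [wordSim_append_singleton, image_comp]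
    exact (image_mono ih).trans ((S.sim_image_interior_subset j _).trans
      (interior_mono (h.maps j)))

lemma wordSim_append_image_subset (h : S.IsGenerator F G) (w : List (Fin J)) (j : Fin J) :
    S.wordSim (w ++ [j]) '' G ⊆ interior (S.sim j '' convexHull ℝ F) := by
  rw [wordSim_append_singleton, image_comp]
  exact (image_mono (h.wordSim_image_subset w)).trans (S.sim_image_interior_subset j _)

lemma disjoint_append (h : S.IsGenerator F G) (w : List (Fin J)) (j : Fin J) :
    Disjoint (S.wordSim [] '' G) (S.wordSim (w ++ [j]) '' G) := by
  have h1 : S.wordSim [] '' G = G := by simp [wordSim]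
  rw [h1]
  exact (h.disjoint j).mono_right ((h.wordSim_append_image_subset w j).trans interior_subset)

/-- Equal last letters cancel by injectivity; different ones place the tiles in disjoint interiors
of `Φ_i(C)` and `Φ_j(C)`; if one word is empty, its tile `G` avoids every `Φ_j(C)`. -/
lemma pairwise_disjoint (h : S.IsGenerator F G) :
    Pairwise fun w u => Disjoint (S.wordSim w '' G) (S.wordSim u '' G) := by
  intro w
  induction w using List.reverseRecOn with
  | nil =>
    intro u hu
    rcases u.eq_nil_or_concat' with rfl | ⟨u, j, rfl⟩
    · exact absurd rfl hu
    · exact h.disjoint_append u j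
  | append_singleton w i ih =>
    intro u hu
    rcases u.eq_nil_or_concat' with rfl | ⟨u, j, rfl⟩
    · exact (h.disjoint_append w i).symm
    · by_cases hij : i = j
      · subst hij
        rw [wordSim_append_singleton, wordSim_append_singleton, image_comp, image_comp]
        refine (disjoint_image_iff ?_).2 (ih fun hwu => hu (by rw [hwu]))
        rw [sim_eq_similitude]
        exact (similitude _ _ _ _).injective
      · exact (h.hull_disjoint i j hij).mono (h.wordSim_append_image_subset w i)
          (h.wordSim_append_image_subset u j)

lemma isBounded (h : S.IsGenerator F G) : Bornology.IsBounded G :=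
  h.isCompact.isBounded.subset (h.subset.trans interior_subset)

lemma isBounded_iUnion (h : S.IsGenerator F G) :
    Bornology.IsBounded (⋃ w, S.wordSim w '' G) :=
  h.isCompact.isBounded.subset
    (iUnion_subset fun w => (h.wordSim_image_subset w).trans interior_subset)

lemma hasSum_tubeVolume (h : S.IsGenerator F G) (ε : ℝ) :
    HasSum (fun w => S.wordRatio w ^ d * tubeVolume G (ε / S.wordRatio w))
      (tubeVolume (⋃ w, S.wordSim w '' G) ε) := by
  have := h.nontrivial
  have hopen : ∀ w, IsOpen (S.wordSim w '' G) := by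
    intro w
    obtain ⟨M, b, hw⟩ := S.exists_wordSim_eq w
    rw [hw]
    exact (Homeomorph.isOpenMap _) _ h.isOpen
  convert hasSum_tubeVolume_iUnion hopen h.pairwise_disjoint h.isBounded_iUnion ε using 2 with w
  obtain ⟨M, b, hw⟩ := S.exists_wordSim_eq w
  rw [hw, tubeVolume_similitude _ _ _ h.isOpen.measurableSet]

/-- Inside `int C` the set `G` and the images `Φ_j(int C)` are disjoint, so `vol G + ∑_j r_j^d vol C
≤ vol C`, and `vol G > 0` makes the inequality for the ratios strict. -/
lemma moran_lt_one (h : S.IsGenerator F G) : S.moran d < 1 := by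
  set I := interior (convexHull ℝ F) with hI
  have hIm : MeasurableSet I := isOpen_interior.measurableSet
  have hfin : volume I ≠ ⊤ := (h.isCompact.isBounded.subset interior_subset).measure_lt_top.ne
  have hGpos : 0 < volume.real G :=
    ENNReal.toReal_pos (h.isOpen.measure_pos volume h.nonempty).ne' h.isBounded.measure_lt_top.ne
  have hIpos : 0 < volume.real I :=
    ENNReal.toReal_pos (isOpen_interior.measure_pos volume (h.nonempty.mono h.subset)).ne' hfin
  have hvol : ∀ j, volume.real (S.sim j '' I) = S.ratio j ^ d * volume.real I := by
    intro j
    rw [sim_eq_similitude, measureReal_def, volume_similitude_image _ _ _ hIm, ENNReal.toReal_mul,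
      ENNReal.toReal_ofReal (pow_pos (S.ratio_pos j) d).le]
    rfl
  have himg : ∀ j, S.sim j '' I ⊆ interior (S.sim j '' convexHull ℝ F) :=
    fun j => S.sim_image_interior_subset j _
  have hsubI : ∀ j, S.sim j '' I ⊆ I := fun j => (himg j).trans (interior_mono (h.maps j))
  have hmeas : ∀ j, MeasurableSet (S.sim j '' I) := fun j => by
    rw [sim_eq_similitude]
    exact ((Homeomorph.isOpenMap _) _ isOpen_interior).measurableSet
  have hdis : Pairwise (Function.onFun Disjoint fun j => S.sim j '' I) := fun i j hij =>
    (h.hull_disjoint i j hij).mono (himg i) (himg j)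
  have hsum : volume.real (⋃ j, S.sim j '' I) = ∑ j, S.ratio j ^ d * volume.real I := by
    rw [measureReal_iUnion_fintype hdis hmeas
      fun j => ((measure_mono (hsubI j)).trans_lt hfin.lt_top).ne]
    exact Finset.sum_congr rfl fun j _ => hvol j
  have hGd : Disjoint G (⋃ j, S.sim j '' I) := by
    rw [disjoint_iUnion_right]
    exact fun j => (h.disjoint j).mono_right ((himg j).trans interior_subset)
  have hle : volume.real G + volume.real (⋃ j, S.sim j '' I) ≤ volume.real I := by
    have hsub : (⋃ j, S.sim j '' I) ⊆ I := iUnion_subset hsubI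
    rw [← measureReal_union hGd (MeasurableSet.iUnion hmeas) h.isBounded.measure_lt_top.ne
      ((measure_mono hsub).trans_lt hfin.lt_top).ne]
    exact measureReal_mono (union_subset h.subset hsub) hfin
  rw [hsum, ← Finset.sum_mul] at hle
  have : S.moran d = ∑ j, S.ratio j ^ d := by simp [moran]
  rw [this]
  by_contra! hge
  nlinarith

end IsGenerator

lemma sUnion_tiling (hG : S.generators F = {G}) :
    ⋃₀ S.tiling F = ⋃ w, S.wordSim w '' G := by
  ext x
  simp [tiling, hG]

end SelfSimilarSystem

/-! ### Mellin transforms of tube volumes -/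

/-- Supplies integrability of the sum, while `hasSum_integral_of_summable_integral_norm` supplies
the value of its integral. -/
lemma integrable_of_hasSum {α ι : Type*} [MeasurableSpace α] {μ : Measure α} [Countable ι]
    {F : ι → α → ℂ} {f : α → ℂ} (hF : ∀ i, Integrable (F i) μ)
    (hsum : Summable fun i => ∫ a, ‖F i a‖ ∂μ) (hf : ∀ᵐ a ∂μ, HasSum (F · a) (f a))
    (hm : AEStronglyMeasurable f μ) : Integrable f μ := by
  refine ⟨hm, ?_⟩
  have h1 : ∫⁻ a, ‖f a‖ₑ ∂μ ≤ ∫⁻ a, ∑' i, ‖F i a‖ₑ ∂μ := by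
    refine lintegral_mono_ae ?_
    filter_upwards [hf] with a ha
    rw [← ha.tsum_eq]
    exact enorm_tsum_le_tsum_enorm
  refine h1.trans_lt ?_
  rw [lintegral_tsum fun i => (hF i).1.enorm]
  simp only [← ofReal_integral_norm_eq_lintegral_enorm (hF _)]
  exact hsum.tsum_ofReal_lt_top

lemma integrableOn_Ioc_cpow {g : ℝ} (hg : 0 < g) {z : ℂ} (hz : 0 < z.re) :
    IntegrableOn (fun t : ℝ => (t : ℂ) ^ (z - 1)) (Ioc 0 g) ∧
      ∫ t in Ioc 0 g, (t : ℂ) ^ (z - 1) = (g : ℂ) ^ z / z := by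
  have hre : -1 < (z - 1).re := by simp; linarith
  have hz0 : z ≠ 0 := fun h => by simp [h] at hz
  constructor
  · rw [← intervalIntegrable_iff_integrableOn_Ioc_of_le hg.le]
    exact intervalIntegral.intervalIntegrable_cpow' hre
  · rw [← intervalIntegral.integral_of_le hg.le, integral_cpow (Or.inl hre)]
    simp [Complex.zero_cpow hz0]

/-- Integrability at `0` is governed by the exponent `k = d - 1` and at infinity by the constant
`vol G`; this is the strip `d - 1 < Re s < d`. The tail beyond `g` produces the term `k = d`, and
its sign explains `κ d = -vol G`. -/
lemma hasMellin_tubeVolume {d : ℕ} [Nontrivial (E d)] {G : Set (E d)} {κ : ℕ → ℝ}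
    (hGb : Bornology.IsBounded G) (hg : 0 < inradius G) (hκ : IsMonophaseWith G κ) {s : ℂ}
    (h1 : (d : ℝ) - 1 < s.re) (h2 : s.re < d) :
    HasMellin (fun t => (tubeVolume G t : ℂ)) (s - d) (generatorSum G κ s) := by
  set g := inradius G with hgdef
  have hpos : ∀ k ∈ Finset.range d, 0 < (s - k).re := by
    intro k hk
    have : (k : ℝ) + 1 ≤ d := by exact_mod_cast Finset.mem_range.1 hk
    simp only [Complex.sub_re, Complex.natCast_re]
    linarith
  set P : ℝ → ℂ := fun t => ∑ k ∈ Finset.range d, (κ k : ℂ) * (t : ℂ) ^ (s - k - 1) with hP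
  have hPi : IntegrableOn P (Ioc 0 g) ∧ ∫ t in Ioc 0 g, P t =
      ∑ k ∈ Finset.range d, (g : ℂ) ^ (s - k) / (s - k) * κ k := by
    constructor
    · exact integrable_finsetSum _ fun k hk =>
        (integrableOn_Ioc_cpow hg (hpos k hk)).1.const_mul _
    · rw [integral_finsetSum _ fun k hk =>
        (integrableOn_Ioc_cpow hg (hpos k hk)).1.const_mul _]
      refine Finset.sum_congr rfl fun k hk => ?_
      rw [integral_const_mul, (integrableOn_Ioc_cpow hg (hpos k hk)).2, mul_comm]
  have hcong1 : ∀ t ∈ Ioo 0 g,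
      (t : ℂ) ^ (s - d - 1) • (tubeVolume G t : ℂ) = P t := by
    intro t ht
    have ht0 : (t : ℂ) ≠ 0 := by exact_mod_cast ht.1.ne'
    rw [hκ.1 t ht.1.le ht.2, hP]
    simp only [smul_eq_mul, Complex.ofReal_sum, Complex.ofReal_mul, Complex.ofReal_pow,
      Finset.mul_sum]
    refine Finset.sum_congr rfl fun k hk => ?_
    have hkd : k ≤ d := (Finset.mem_range.1 hk).le
    have : s - k - 1 = (s - d - 1) + ((d - k : ℕ) : ℂ) := by
      rw [Nat.cast_sub hkd]; ring
    rw [this, Complex.cpow_add _ _ ht0, Complex.cpow_natCast]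
    ring
  have hcong2 : ∀ t ∈ Ioi g,
      (t : ℂ) ^ (s - d - 1) • (tubeVolume G t : ℂ) = (t : ℂ) ^ (s - d - 1) * (-κ d : ℂ) := by
    intro t ht
    rw [tubeVolume_eq_volume hGb hg (le_of_lt ht), hκ.2]
    simp
  have hre : (s - d - 1).re < -1 := by simp; linarith
  have hI1 : IntegrableOn (fun t : ℝ => (t : ℂ) ^ (s - d - 1) • (tubeVolume G t : ℂ)) (Ioc 0 g) := by
    rw [integrableOn_Ioc_iff_integrableOn_Ioo]
    exact (hPi.1.mono_set Ioo_subset_Ioc_self).congr_fun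
      (fun t ht => (hcong1 t ht).symm) measurableSet_Ioo
  have hI2 : IntegrableOn (fun t : ℝ => (t : ℂ) ^ (s - d - 1) • (tubeVolume G t : ℂ)) (Ioi g) :=
    IntegrableOn.congr_fun ((integrableOn_Ioi_cpow_of_lt hre hg).mul_const _)
      (fun t ht => (hcong2 t ht).symm) measurableSet_Ioi
  have hun : Ioi (0 : ℝ) = Ioc 0 g ∪ Ioi g := (Ioc_union_Ioi_eq_Ioi hg.le).symm
  constructor
  · rw [MellinConvergent, hun]
    exact hI1.union hI2
  · rw [mellin, hun, setIntegral_union (Ioc_disjoint_Ioi le_rfl) measurableSet_Ioi hI1 hI2,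
      integral_Ioc_eq_integral_Ioo, setIntegral_congr_fun measurableSet_Ioo hcong1,
      ← integral_Ioc_eq_integral_Ioo, hPi.2, setIntegral_congr_fun measurableSet_Ioi hcong2,
      integral_mul_const, integral_Ioi_cpow_of_lt hre hg, generatorSum, Finset.sum_range_succ]
    congr 1
    rw [sub_add_cancel]
    ring

namespace SelfSimilarSystem.IsGenerator

variable {d J : ℕ} {S : SelfSimilarSystem d J} {F G : Set (E d)}

lemma hasMellin_tile {s : ℂ} {m : ℂ} (h : HasMellin (fun t => (tubeVolume G t : ℂ)) (s - d) m)
    {r : ℝ} (hr : 0 < r) :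
    HasMellin (fun t => ((r ^ d * tubeVolume G (t / r) : ℝ) : ℂ)) (s - d) ((r : ℂ) ^ s * m) := by
  have hfun : (fun t => ((r ^ d * tubeVolume G (t / r) : ℝ) : ℂ)) =
      fun t => ((r : ℂ) ^ d) • (fun t => (tubeVolume G t : ℂ)) (r⁻¹ * t) := by
    ext t
    simp only [smul_eq_mul]
    push_cast
    rw [div_eq_inv_mul]
  have hri : 0 < r⁻¹ := inv_pos.2 hr
  have hrc : (r : ℂ) ≠ 0 := by exact_mod_cast hr.ne'
  rw [hfun]
  constructor
  · exact ((MellinConvergent.comp_mul_left hri).2 h.1).const_smul _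
  · have hinv : ((r⁻¹ : ℝ) : ℂ) ^ (-(s - d)) = (r : ℂ) ^ (s - d) := by
      rw [Complex.ofReal_inv, Complex.inv_cpow _ _ (by
        rw [Complex.arg_ofReal_of_nonneg hr.le]; exact Real.pi_pos.ne), Complex.cpow_neg, inv_inv]
    have := mellin_comp_mul_left (fun t => (tubeVolume G t : ℂ)) (s - d) hri
    rw [mellin_const_smul, this, h.2, hinv, smul_eq_mul, smul_eq_mul, ← mul_assoc,
      ← Complex.cpow_natCast, ← Complex.cpow_add _ _ hrc]
    congr 2
    ring

/-- Tube volumes are nonnegative, so the integral of the norm is the Mellin transform at the real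
point `Re s`, and scaling turns it into a constant times `r_w^(Re s)`. -/
lemma summable_norm_tile {s : ℂ} (h : S.IsGenerator F G) {κ : ℕ → ℝ} (hg : 0 < inradius G)
    (hκ : IsMonophaseWith G κ) (h1 : (d : ℝ) - 1 < s.re) (h2 : s.re < d)
    (hs : S.moran s.re < 1) :
    Summable fun w : List (Fin J) => ∫ t in Ioi (0 : ℝ), ‖(t : ℂ) ^ (s - d - 1) •
      ((S.wordRatio w ^ d * tubeVolume G (t / S.wordRatio w) : ℝ) : ℂ)‖ := by
  have := h.nontrivial
  have hM := hasMellin_tubeVolume (s := (s.re : ℂ)) h.isBounded hg hκ (by simpa using h1)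
    (by simpa using h2)
  have key : ∀ w : List (Fin J), ∫ t in Ioi (0 : ℝ), ‖(t : ℂ) ^ (s - d - 1) •
      ((S.wordRatio w ^ d * tubeVolume G (t / S.wordRatio w) : ℝ) : ℂ)‖ =
      S.wordRatio w ^ s.re * ‖generatorSum G κ s.re‖ := by
    intro w
    have hr := S.wordRatio_pos w
    have h3 : ((∫ t in Ioi (0 : ℝ), ‖(t : ℂ) ^ (s - d - 1) •
        ((S.wordRatio w ^ d * tubeVolume G (t / S.wordRatio w) : ℝ) : ℂ)‖ : ℝ) : ℂ) =
        (S.wordRatio w : ℂ) ^ (s.re : ℂ) * generatorSum G κ s.re := by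
      rw [← (hasMellin_tile hM hr).2, mellin, ← integral_complex_ofReal]
      refine setIntegral_congr_fun measurableSet_Ioi fun t ht => ?_
      have ht' : (0 : ℝ) < t := ht
      have hn : 0 ≤ S.wordRatio w ^ d * tubeVolume G (t / S.wordRatio w) :=
        mul_nonneg (pow_pos hr d).le (tubeVolume_nonneg _ _)
      simp only [smul_eq_mul, norm_mul, Complex.norm_cpow_eq_rpow_re_of_pos ht', Complex.norm_real,
        Real.norm_of_nonneg hn]
      rw [Complex.ofReal_mul, Complex.ofReal_cpow ht'.le]
      congr 2
      simp
    have h4 := congrArg norm h3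
    rw [Complex.norm_real, Real.norm_of_nonneg (integral_nonneg fun _ => norm_nonneg _), norm_mul,
      Complex.norm_cpow_eq_rpow_re_of_pos hr] at h4
    simpa using h4
  simp only [key]
  exact (S.summable_wordRatio_rpow hs).mul_right _

lemma measurable_tubeVolume {A : Set (E d)} (hA : Bornology.IsBounded A) :
    Measurable (tubeVolume A) := (tubeVolume_mono hA).measurable

lemma hasMellin_tiling {s : ℂ} (h : S.IsGenerator F G) {κ : ℕ → ℝ} (hg : 0 < inradius G)
    (hκ : IsMonophaseWith G κ) (h1 : (d : ℝ) - 1 < s.re) (h2 : s.re < d)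
    (hs : S.moran s.re < 1) :
    HasMellin (fun t => (tubeVolume (⋃ w, S.wordSim w '' G) t : ℂ)) (s - d)
      (S.scalingZeta s * generatorSum G κ s) := by
  have := h.nontrivial
  have hM := hasMellin_tubeVolume h.isBounded hg hκ h1 h2
  have hint := fun w => (hasMellin_tile hM (S.wordRatio_pos w)).1
  have hsm := h.summable_norm_tile hg hκ h1 h2 hs
  have hpt : ∀ t : ℝ, HasSum (fun w : List (Fin J) => (t : ℂ) ^ (s - d - 1) •
      ((S.wordRatio w ^ d * tubeVolume G (t / S.wordRatio w) : ℝ) : ℂ))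
      ((t : ℂ) ^ (s - d - 1) • (tubeVolume (⋃ w, S.wordSim w '' G) t : ℂ)) := fun t =>
    (Complex.hasSum_ofReal.2 (h.hasSum_tubeVolume t)).const_smul _
  constructor
  · refine integrable_of_hasSum hint hsm (.of_forall hpt) ?_
    refine Measurable.aestronglyMeasurable ?_
    exact (Complex.measurable_ofReal.pow_const _).smul
      (Complex.measurable_ofReal.comp (measurable_tubeVolume h.isBounded_iUnion))
  · have hsum := hasSum_integral_of_summable_integral_norm hint hsm
    have heq : ∀ w, ∫ t in Ioi (0 : ℝ), (t : ℂ) ^ (s - d - 1) •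
        ((S.wordRatio w ^ d * tubeVolume G (t / S.wordRatio w) : ℝ) : ℂ) =
        (S.wordRatio w : ℂ) ^ s * generatorSum G κ s :=
      fun w => (hasMellin_tile hM (S.wordRatio_pos w)).2
    simp only [heq, (hpt _).tsum_eq] at hsum
    rw [scalingZeta_eq]
    exact hsum.unique ((S.hasSum_wordRatio_cpow hs).mul_right _)

end SelfSimilarSystem.IsGenerator

/-! ### The pairing with powers -/

lemma powPairing_eq_mellin (z : ℂ) (φ : ℝ → ℂ) : powPairing z φ = mellin φ (z + 1) := by
  simp [powPairing, mellin]

/-- Smooth functions that vanish outside `[a, b]`. -/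
def IsSmoothSupportedOn (a b : ℝ) (φ : ℝ → ℂ) : Prop :=
  ContDiff ℝ ∞ φ ∧ Function.support φ ⊆ Icc a b

namespace IsSmoothSupportedOn

variable {a b : ℝ} {φ : ℝ → ℂ}

lemma eq_zero (h : IsSmoothSupportedOn a b φ) {x : ℝ} (hx : x ∉ Icc a b) : φ x = 0 := by
  by_contra h0
  exact hx (h.2 h0)

lemma deriv (h : IsSmoothSupportedOn a b φ) : IsSmoothSupportedOn a b (deriv φ) := by
  refine ⟨((contDiff_infty_iff_deriv).1 h.1).2, ?_⟩
  exact support_deriv_subset.trans (closure_minimal h.2 isClosed_Icc)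

lemma integrable (h : IsSmoothSupportedOn a b φ) : Integrable φ :=
  h.1.continuous.integrable_of_hasCompactSupport
    (HasCompactSupport.intro isCompact_Icc fun _ hx => h.eq_zero hx)

lemma powPairing_eq_intervalIntegral (h : IsSmoothSupportedOn a b φ) (ha : 0 < a) (hab : a ≤ b)
    (z : ℂ) : powPairing z φ = ∫ ε in (a / 2)..(b + 1), (ε : ℂ) ^ z * φ ε := by
  rw [powPairing, intervalIntegral.integral_of_le (by linarith)]
  refine setIntegral_eq_of_subset_of_forall_sdiff_eq_zero measurableSet_Ioi
    (fun x hx => lt_trans (by linarith) hx.1) fun x hx => ?_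
  rw [h.eq_zero, mul_zero]
  exact fun hx' => hx.2 ⟨by linarith [hx'.1], by linarith [hx'.2]⟩

/-- Integration by parts; `φ` vanishes at the endpoints `a / 2` and `b + 1`. For `z = -1` the claim
reduces to `∫ φ' = 0`. -/
lemma powPairing_deriv (h : IsSmoothSupportedOn a b φ) (ha : 0 < a) (hab : a ≤ b) (z : ℂ) :
    (z + 1) * powPairing z φ = -powPairing (z + 1) (_root_.deriv φ) := by
  rcases eq_or_ne (z + 1) 0 with hz | hz
  · rw [hz, zero_mul, h.deriv.powPairing_eq_intervalIntegral ha hab]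
    have hd : ∀ x, HasDerivAt φ (_root_.deriv φ x) x := fun x =>
      (h.1.differentiable (by simp) x).hasDerivAt
    simp only [Complex.cpow_zero, one_mul]
    rw [intervalIntegral.integral_eq_sub_of_hasDerivAt (fun x _ => hd x)
      (h.deriv.1.continuous.intervalIntegrable _ _), h.eq_zero (x := b + 1) (fun hx => by linarith [hx.2]),
      h.eq_zero (x := a / 2) (fun hx => by linarith [hx.1])]
    simp
  · rw [h.powPairing_eq_intervalIntegral ha hab, h.deriv.powPairing_eq_intervalIntegral ha hab]
    have hpos : ∀ x ∈ uIcc (a / 2) (b + 1), 0 < x := fun x hx => by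
      rw [uIcc_of_le (by linarith)] at hx
      linarith [hx.1]
    have hd : ∀ x, HasDerivAt φ (_root_.deriv φ x) x := fun x =>
      (h.1.differentiable (by simp) x).hasDerivAt
    have hpow : ∀ x ∈ uIcc (a / 2) (b + 1),
        HasDerivAt (fun x : ℝ => (x : ℂ) ^ (z + 1)) ((z + 1) * (x : ℂ) ^ z) x := by
      intro x hx
      have := (hasDerivAt_id (x : ℂ)).cpow_const (c := z + 1)
        (Or.inl (by simpa using hpos x hx))
      simpa using this.comp_ofReal
    have hc : ∀ (u : ℂ) (ψ : ℝ → ℂ), Continuous ψ →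
        ContinuousOn (fun x : ℝ => (x : ℂ) ^ u * ψ x) (uIcc (a / 2) (b + 1)) := by
      intro u ψ hψ
      refine ContinuousOn.mul (fun x hx => ?_) hψ.continuousOn
      exact (Complex.continuousAt_ofReal_cpow_const x u (Or.inr (hpos x hx).ne')).continuousWithinAt
    have hc1 := ((hc z φ h.1.continuous).intervalIntegrable (μ := volume)).const_mul (z + 1)
    have hc2 := (hc (z + 1) _ h.deriv.1.continuous).intervalIntegrable (μ := volume)
    have := intervalIntegral.integral_eq_sub_of_hasDerivAt
      (f := fun x : ℝ => (x : ℂ) ^ (z + 1) * φ x)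
      (f' := fun x : ℝ => (z + 1) * ((x : ℂ) ^ z * φ x) + (x : ℂ) ^ (z + 1) * _root_.deriv φ x)
      (fun x hx => ((hpow x hx).mul (hd x)).congr_deriv (by rw [mul_assoc])) (hc1.add hc2)
    rw [intervalIntegral.integral_add hc1 hc2, intervalIntegral.integral_const_mul,
      h.eq_zero (x := b + 1) (fun hx => by linarith [hx.2]),
      h.eq_zero (x := a / 2) (fun hx => by linarith [hx.1])] at this
    rw [eq_neg_iff_add_eq_zero, this]
    ring

lemma norm_powPairing_le (h : IsSmoothSupportedOn a b φ) {z : ℂ}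
    (hz : 0 ≤ z.re) : ‖powPairing z φ‖ ≤ b ^ z.re * ∫ ε in Ioi (0 : ℝ), ‖φ ε‖ := by
  rw [← integral_const_mul, powPairing]
  refine norm_integral_le_of_norm_le (h.integrable.norm.integrableOn.const_mul _) ?_
  refine (ae_restrict_iff' measurableSet_Ioi).2 (.of_forall fun ε hε => ?_)
  have hε' : 0 < ε := hε
  rw [norm_mul, Complex.norm_cpow_eq_rpow_re_of_pos hε']
  by_cases hm : ε ∈ Icc a b
  · exact mul_le_mul_of_nonneg_right (Real.rpow_le_rpow hε'.le hm.2 hz) (norm_nonneg _)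
  · simp [h.eq_zero hm]

/-- Each integration by parts gains a factor `z + 1`, which dominates `|z.im|`, and shifts `z` by
one, which costs a factor `b`. The induction ranges over all `φ` because it passes to the
derivative. -/
lemma exists_im_pow_mul_le (ha : 0 < a) (hab : a ≤ b) (N : ℕ) :
    ∀ {φ : ℝ → ℂ}, IsSmoothSupportedOn a b φ → ∃ C : ℝ, 0 ≤ C ∧ ∀ z : ℂ, 0 ≤ z.re →
      |z.im| ^ N * ‖powPairing z φ‖ ≤ C * b ^ z.re := by
  have hb : 0 < b := ha.trans_le hab
  induction N with
  | zero =>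
    intro φ h
    refine ⟨∫ ε in Ioi (0 : ℝ), ‖φ ε‖, integral_nonneg fun _ => norm_nonneg _, fun z hz => ?_⟩
    rw [pow_zero, one_mul, mul_comm]
    exact h.norm_powPairing_le hz
  | succ N ih =>
    intro φ h
    obtain ⟨C, hC, hle⟩ := ih h.deriv
    refine ⟨C * b, by positivity, fun z hz => ?_⟩
    have h1 := hle (z + 1) (by simp; linarith)
    have h2 : |z.im| * ‖powPairing z φ‖ ≤ ‖powPairing (z + 1) (_root_.deriv φ)‖ := by
      have := congrArg norm (h.powPairing_deriv ha hab z)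
      rw [norm_mul, norm_neg] at this
      rw [← this]
      refine mul_le_mul_of_nonneg_right ?_ (norm_nonneg _)
      simpa using Complex.abs_im_le_norm (z + 1)
    simp only [Complex.add_im, Complex.one_im, add_zero, Complex.add_re, Complex.one_re] at h1
    rw [Real.rpow_add hb, Real.rpow_one] at h1
    calc |z.im| ^ (N + 1) * ‖powPairing z φ‖ = |z.im| ^ N * (|z.im| * ‖powPairing z φ‖) := by ring
      _ ≤ |z.im| ^ N * ‖powPairing (z + 1) (_root_.deriv φ)‖ :=
        mul_le_mul_of_nonneg_left h2 (by positivity)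
      _ ≤ C * (b ^ z.re * b) := h1
      _ = C * b * b ^ z.re := by ring

lemma exists_norm_powPairing_le (h : IsSmoothSupportedOn a b φ) (ha : 0 < a) (hab : a ≤ b)
    (N : ℕ) : ∃ C : ℝ, 0 ≤ C ∧ ∀ z : ℂ, 0 ≤ z.re →
      ‖powPairing z φ‖ ≤ C * b ^ z.re / (1 + |z.im|) ^ N := by
  obtain ⟨C₀, h0, hle0⟩ := exists_im_pow_mul_le ha hab 0 h
  obtain ⟨C₁, h1, hle1⟩ := exists_im_pow_mul_le ha hab N h
  refine ⟨2 ^ (N - 1) * (C₀ + C₁), by positivity, fun z hz => ?_⟩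
  rw [le_div_iff₀ (by positivity)]
  have h2 := add_pow_le (zero_le_one (α := ℝ)) (abs_nonneg z.im) N
  rw [one_pow] at h2
  have h3 := hle0 z hz
  rw [pow_zero, one_mul] at h3
  calc ‖powPairing z φ‖ * (1 + |z.im|) ^ N
      ≤ ‖powPairing z φ‖ * (2 ^ (N - 1) * (1 + |z.im| ^ N)) :=
        mul_le_mul_of_nonneg_left h2 (norm_nonneg _)
    _ = 2 ^ (N - 1) * (‖powPairing z φ‖ + |z.im| ^ N * ‖powPairing z φ‖) := by ring
    _ ≤ 2 ^ (N - 1) * (C₀ * b ^ z.re + C₁ * b ^ z.re) := by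
        have := hle1 z hz
        gcongr
    _ = 2 ^ (N - 1) * (C₀ + C₁) * b ^ z.re := by ring

lemma mellin_isBigO (h : IsSmoothSupportedOn a b φ) (ha : 0 < a) (u : ℝ) :
    (φ =O[atTop] fun x : ℝ => x ^ (-u)) ∧ (φ =O[𝓝[>] 0] fun x : ℝ => x ^ (-u)) := by
  constructor
  · refine (Asymptotics.isBigO_zero _ _).congr' ?_ .rfl
    filter_upwards [eventually_gt_atTop b] with x hx
    exact (h.eq_zero fun hx' => by linarith [hx'.2]).symm
  · refine (Asymptotics.isBigO_zero _ _).congr' ?_ .rfl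
    filter_upwards [Ioo_mem_nhdsGT ha] with x hx
    exact (h.eq_zero fun hx' => by linarith [hx'.1, hx.2]).symm

lemma mellinConvergent (h : IsSmoothSupportedOn a b φ) (ha : 0 < a) (z : ℂ) :
    MellinConvergent φ z :=
  mellinConvergent_of_isBigO_rpow (a := z.re + 1) (b := z.re - 1)
    (h.1.continuous.locallyIntegrable.locallyIntegrableOn _) (h.mellin_isBigO ha _).1
    (by linarith) (h.mellin_isBigO ha _).2 (by linarith)

lemma differentiable_mellin (h : IsSmoothSupportedOn a b φ) (ha : 0 < a) :
    Differentiable ℂ (mellin φ) := fun z =>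
  mellin_differentiableAt_of_isBigO_rpow (a := z.re + 1) (b := z.re - 1)
    (h.1.continuous.locallyIntegrable.locallyIntegrableOn _) (h.mellin_isBigO ha _).1
    (by linarith) (h.mellin_isBigO ha _).2 (by linarith)

lemma differentiable_powPairing (h : IsSmoothSupportedOn a b φ) (ha : 0 < a) :
    Differentiable ℂ fun z => powPairing z φ := by
  simp only [powPairing_eq_mellin]
  exact (h.differentiable_mellin ha).comp (differentiable_id.add_const 1)

lemma verticalIntegrable_mellin (h : IsSmoothSupportedOn a b φ) (ha : 0 < a) (hab : a ≤ b) {σ : ℝ}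
    (hσ : 1 ≤ σ) : Complex.VerticalIntegrable (mellin φ) σ := by
  obtain ⟨C, hC, hle⟩ := h.exists_norm_powPairing_le ha hab 2
  have hc : Continuous fun y : ℝ => mellin φ (σ + y * Complex.I) :=
    (h.differentiable_mellin ha).continuous.comp (by fun_prop)
  refine (integrable_inv_one_add_sq.const_mul (C * b ^ (σ - 1))).mono' hc.aestronglyMeasurable
    (.of_forall fun y => ?_)
  have h1 := hle (σ - 1 + y * Complex.I) (by simp; linarith)
  rw [powPairing_eq_mellin, show (σ : ℂ) - 1 + y * Complex.I + 1 = σ + y * Complex.I by ring] at h1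
  simp only [Complex.add_re, Complex.sub_re, Complex.ofReal_re, Complex.one_re, Complex.mul_re,
    Complex.I_re, mul_zero, Complex.ofReal_im, Complex.I_im, mul_one, sub_self, add_zero,
    Complex.add_im, Complex.sub_im, Complex.one_im, Complex.mul_im, zero_add] at h1
  refine h1.trans ?_
  rw [div_eq_mul_inv]
  have hb : 0 ≤ b ^ (σ - 1) := Real.rpow_nonneg (ha.le.trans hab) _
  refine mul_le_mul_of_nonneg_left (inv_anti₀ (by positivity) ?_) (by positivity)
  nlinarith [abs_nonneg y, sq_abs y]

end IsSmoothSupportedOn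

/-- The Parseval identity for the Mellin transform, against a smooth function supported in
`[a, b]`. -/
lemma integral_mul_eq_mellin {a b : ℝ} {φ : ℝ → ℂ} (h : IsSmoothSupportedOn a b φ) (ha : 0 < a)
    (hab : a ≤ b) {V : ℝ → ℂ} (hVm : Measurable V) {σ : ℝ} (hσ : 1 ≤ σ)
    (hV : MellinConvergent V (1 - σ)) :
    IntegrableOn (fun x => V x * φ x) (Ioi 0) ∧
    ∫ x in Ioi (0 : ℝ), V x * φ x =
      (1 / (2 * Real.pi)) * ∫ y : ℝ, mellin V (1 - σ + y * Complex.I) *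
        mellin φ (σ - y * Complex.I) := by
  have hvert := h.verticalIntegrable_mellin ha hab hσ
  have hinv : ∀ x : ℝ, 0 < x → φ x = (1 / (2 * Real.pi)) *
      ∫ y : ℝ, (x : ℂ) ^ (-(σ + y * Complex.I)) * mellin φ (σ + y * Complex.I) := by
    intro x hx
    rw [← mellinInv_mellin_eq σ φ hx (h.mellinConvergent ha σ) hvert h.1.continuous.continuousAt,
      mellinInv]
    simp
  set K : ℝ → ℝ → ℂ := fun x y =>
    V x * ((x : ℂ) ^ (-(σ + y * Complex.I)) * mellin φ (σ + y * Complex.I)) with hK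
  have hMc : Continuous fun y : ℝ => mellin φ (σ + y * Complex.I) :=
    (h.differentiable_mellin ha).continuous.comp (by fun_prop)
  -- For Fubini: the norm of `K x y` splits into `x^(-σ) ‖V x‖` times the norm of the transform of
  -- `φ`.
  have hKint : Integrable (Function.uncurry K) ((volume.restrict (Ioi 0)).prod volume) := by
    refine (Integrable.mul_prod (Integrable.norm hV) (Integrable.norm hvert)).mono' ?_ ?_
    · refine Measurable.aestronglyMeasurable ?_
      refine (hVm.comp measurable_fst).mul (Measurable.mul ?_ (hMc.measurable.comp measurable_snd))
      exact (Complex.measurable_ofReal.comp measurable_fst).pow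
        ((Continuous.measurable (by fun_prop : Continuous fun p : ℝ × ℝ =>
          -((σ : ℂ) + p.2 * Complex.I))))
    · have : ∀ᵐ p : ℝ × ℝ ∂((volume.restrict (Ioi 0)).prod volume), 0 < p.1 := by
        have h0 : ∀ᵐ x : ℝ ∂volume.restrict (Ioi 0), 0 < x := ae_restrict_mem measurableSet_Ioi
        exact Measure.quasiMeasurePreserving_fst.ae h0
      filter_upwards [this] with p hp
      simp only [Function.uncurry, hK, norm_mul, norm_smul, Complex.norm_cpow_eq_rpow_re_of_pos hp]
      refine le_of_eq ?_
      have : (-((σ : ℂ) + p.2 * Complex.I)).re = (1 - (σ : ℂ) - 1).re := by simp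
      rw [this]
      ring
  constructor
  -- `V φ` is the integrable function `x^(-σ) V` times the bounded function `x^σ φ`.
  · have hb : ∃ C, ∀ x : ℝ, 0 < x → ‖(x : ℂ) ^ (σ : ℂ) * φ x‖ ≤ C := by
      obtain ⟨C, hC⟩ := h.1.continuous.bounded_above_of_compact_support
        (HasCompactSupport.intro isCompact_Icc fun _ hx => h.eq_zero hx)
      have hb0 : 0 < b := ha.trans_le hab
      refine ⟨b ^ σ * C, fun x hx => ?_⟩
      rw [norm_mul, Complex.norm_cpow_eq_rpow_re_of_pos hx, Complex.ofReal_re]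
      have hCn : 0 ≤ C := (norm_nonneg _).trans (hC 0)
      by_cases hm : x ∈ Icc a b
      · exact mul_le_mul (Real.rpow_le_rpow hx.le hm.2 (by linarith)) (hC x) (norm_nonneg _)
          (by positivity)
      · rw [h.eq_zero hm, norm_zero, mul_zero]
        positivity
    obtain ⟨C, hC⟩ := hb
    have hint : IntegrableOn (fun x : ℝ => ((x : ℂ) ^ (σ : ℂ) * φ x) *
        ((x : ℂ) ^ (1 - (σ : ℂ) - 1) • V x)) (Ioi 0) := by
      refine Integrable.bdd_mul hV ?_ ((ae_restrict_iff' measurableSet_Ioi).2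
        (.of_forall fun x hx => hC x hx))
      exact ((Complex.measurable_ofReal.pow_const _).mul
        h.1.continuous.measurable).aestronglyMeasurable
    refine hint.congr_fun (fun x hx => ?_) measurableSet_Ioi
    have hx0 : (x : ℂ) ≠ 0 := by exact_mod_cast (ne_of_gt hx)
    have : (x : ℂ) ^ (σ : ℂ) * (x : ℂ) ^ (1 - (σ : ℂ) - 1) = 1 := by
      rw [← Complex.cpow_add _ _ hx0]; simp
    simp only [smul_eq_mul]
    linear_combination (φ x * V x) * this
  · calc ∫ x in Ioi (0 : ℝ), V x * φ x
        = ∫ x in Ioi (0 : ℝ), (1 / (2 * Real.pi)) * ∫ y : ℝ, K x y := by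
          refine setIntegral_congr_fun measurableSet_Ioi fun x hx => ?_
          simp only [hK]
          rw [integral_const_mul]
          conv_lhs => rw [hinv x hx]
          ring
      _ = (1 / (2 * Real.pi)) * ∫ y : ℝ, ∫ x in Ioi (0 : ℝ), K x y := by
          rw [integral_const_mul, integral_integral_swap hKint]
      _ = (1 / (2 * Real.pi)) * ∫ y : ℝ, mellin V (1 - σ - y * Complex.I) *
            mellin φ (σ + y * Complex.I) := by
          congr 2
          ext y
          rw [mellin, ← integral_mul_const]
          refine integral_congr_ae (.of_forall fun x => ?_)
          simp only [hK, smul_eq_mul]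
          rw [show -((σ : ℂ) + y * Complex.I) = 1 - σ - y * Complex.I - 1 by ring]
          ring
      _ = _ := by
          rw [← integral_neg_eq_self]
          congr 2
          ext y
          push_cast
          congr 2 <;> ring

/-! ### Shifting the contour -/

lemma integral_exp_mul_le {l : ℝ} (hl : 0 < l) (u v : ℝ) :
    ∫ x in u..v, Real.exp (l * x) ≤ Real.exp (l * v) / l := by
  have hd : ∀ x : ℝ, HasDerivAt (fun x => Real.exp (l * x) / l) (Real.exp (l * x)) x := by
    intro x
    have := (((hasDerivAt_id x).const_mul l).exp).div_const l
    simpa [hl.ne'] using this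
  rw [intervalIntegral.integral_eq_sub_of_hasDerivAt (fun x _ => hd x)
    (Continuous.intervalIntegrable (by fun_prop) _ _)]
  have : 0 < Real.exp (l * u) / l := by positivity
  linarith

/-- For fixed `n` the left edge goes to `-∞` and drops out, while `P n` does not change; only then
does `n → ∞`. The factor `exp (l * σ)` makes the horizontal edges integrable down to `-∞`, and `(1 +
|T n|)⁻¹` makes them vanish in the limit. -/
lemma tendsto_of_rectIntegral {f : ℂ → ℂ} {c l C σ₀ : ℝ} {T : ℤ → ℝ} {P : ℕ → ℂ} (hl : 0 < l)
    (hC : 0 ≤ C) (hline : Integrable fun y : ℝ => f (c + y * Complex.I))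
    (hleft : ∀ s : ℂ, s.re ≤ σ₀ → ‖f s‖ ≤ C * Real.exp (l * s.re))
    (hhor : ∀ n : ℤ, 1 ≤ |T n| → ∀ σ : ℝ, σ ≤ c →
      ‖f (σ + T n * Complex.I)‖ ≤ C * Real.exp (l * σ) / (1 + |T n|))
    (hrect : ∀ n : ℕ, 1 ≤ T n → T (-n) ≤ -1 → ∀ᶠ R in atTop,
      rectIntegral f (-R) c (T (-n)) (T n) = 2 * Real.pi * Complex.I * P n)
    (htop : Tendsto (fun n : ℕ => T n) atTop atTop)
    (hbot : Tendsto (fun n : ℕ => T (-n)) atTop atBot) :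
    Tendsto P atTop (𝓝 ((1 / (2 * Real.pi)) * ∫ y : ℝ, f (c + y * Complex.I))) := by
  have hbound : ∀ n : ℕ, 1 ≤ T n → T (-n) ≤ -1 →
      ‖2 * Real.pi * P n - ∫ y in T (-n)..T n, f (c + y * Complex.I)‖ ≤
        C * Real.exp (l * c) / l * ((1 + |T (-n)|)⁻¹ + (1 + |T n|)⁻¹) := by
    intro n h1 h2
    have hh : ∀ m : ℤ, 1 ≤ |T m| → ∀ R : ℝ, -R ≤ c →
        ‖∫ x in (-R)..c, f (x + T m * Complex.I)‖ ≤
          C * Real.exp (l * c) / l * (1 + |T m|)⁻¹ := by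
      intro m hm R hR
      have h3 := intervalIntegral.norm_integral_le_of_norm_le (μ := volume) hR
        (f := fun x : ℝ => f (x + T m * Complex.I))
        (g := fun x => C * (1 + |T m|)⁻¹ * Real.exp (l * x))
        (.of_forall fun x hx => (hhor m hm x hx.2).trans (le_of_eq (by rw [div_eq_mul_inv]; ring)))
        (Continuous.intervalIntegrable (by fun_prop) _ _)
      refine h3.trans ?_
      rw [intervalIntegral.integral_const_mul]
      calc C * (1 + |T m|)⁻¹ * ∫ x in (-R)..c, Real.exp (l * x)
          ≤ C * (1 + |T m|)⁻¹ * (Real.exp (l * c) / l) :=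
            mul_le_mul_of_nonneg_left (integral_exp_mul_le hl _ _) (by positivity)
        _ = _ := by ring
    have hlim : Tendsto (fun R : ℝ => C * Real.exp (l * c) / l * ((1 + |T (-n)|)⁻¹ + (1 + |T n|)⁻¹)
        + C * Real.exp (l * (-R)) * (T n - T (-n))) atTop
        (𝓝 (C * Real.exp (l * c) / l * ((1 + |T (-n)|)⁻¹ + (1 + |T n|)⁻¹)
        + C * 0 * (T n - T (-n)))) := by
      refine tendsto_const_nhds.add ((Tendsto.const_mul _ ?_).mul_const _)
      exact Real.tendsto_exp_atBot.comp (tendsto_neg_atTop_atBot.const_mul_atBot hl)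
    rw [mul_zero, zero_mul, add_zero] at hlim
    refine ge_of_tendsto hlim ?_
    filter_upwards [hrect n h1 h2, eventually_ge_atTop (-c), eventually_ge_atTop (-σ₀)]
      with R hR hRc hRσ
    have hB := hh (-n) (by rw [abs_of_neg (by linarith)]; linarith) R (by linarith)
    have hT := hh n (by rw [abs_of_pos (by linarith)]; exact h1) R (by linarith)
    have hL : ‖∫ y in T (-n)..T n, f ((-R : ℝ) + y * Complex.I)‖ ≤
        C * Real.exp (l * (-R)) * (T n - T (-n)) := by
      have := intervalIntegral.norm_integral_le_of_norm_le_const (a := T (-n)) (b := T n)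
        (C := C * Real.exp (l * (-R))) (f := fun y : ℝ => f ((-R : ℝ) + y * Complex.I))
        fun y _ => by
          have := hleft ((-R : ℝ) + y * Complex.I) (by simp; linarith)
          simpa using this
      rwa [abs_of_pos (by linarith)] at this
    rw [rectIntegral] at hR
    have heq : 2 * Real.pi * P n - ∫ y in T (-n)..T n, f (c + y * Complex.I) =
        -Complex.I * (∫ x in (-R)..c, f (x + T (-n) * Complex.I)) +
        Complex.I * (∫ x in (-R)..c, f (x + T n * Complex.I)) -
        ∫ y in T (-n)..T n, f ((-R : ℝ) + y * Complex.I) := by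
      have hI := Complex.I_mul_I
      linear_combination Complex.I * hR + (2 * Real.pi * P n -
        (∫ y in T (-n)..T n, f (c + y * Complex.I)) +
        ∫ y in T (-n)..T n, f ((-R : ℝ) + y * Complex.I)) * hI
    rw [heq]
    refine (norm_sub_le _ _).trans ?_
    refine add_le_add ((norm_add_le _ _).trans ?_) hL
    rw [norm_mul, norm_mul, norm_neg, Complex.norm_I, one_mul, one_mul, mul_add]
    exact add_le_add hB hT
  have hinv : ∀ u : ℕ → ℝ, Tendsto u atTop atTop → Tendsto (fun n => (1 + u n)⁻¹) atTop (𝓝 0) :=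
    fun u hu => tendsto_inv_atTop_zero.comp (tendsto_atTop_add_const_left _ 1 hu)
  have h0 : Tendsto (fun n : ℕ => 2 * Real.pi * P n - ∫ y in T (-n)..T n, f (c + y * Complex.I))
      atTop (𝓝 0) := by
    refine squeeze_zero_norm' (a := fun n : ℕ =>
      C * Real.exp (l * c) / l * ((1 + |T (-n)|)⁻¹ + (1 + |T n|)⁻¹)) ?_ ?_
    · filter_upwards [htop.eventually_ge_atTop 1, hbot.eventually_le_atBot (-1)] with n h1 h2
      exact hbound n h1 h2
    · have := ((hinv _ (tendsto_abs_atBot_atTop.comp hbot)).add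
        (hinv _ (tendsto_abs_atTop_atTop.comp htop))).const_mul (C * Real.exp (l * c) / l)
      simpa using this
  have h1 := h0.add (intervalIntegral_tendsto_integral hline hbot htop)
  simp only [sub_add_cancel, zero_add] at h1
  have h2 := h1.const_mul (1 / (2 * Real.pi) : ℂ)
  refine h2.congr fun n => ?_
  have : (Real.pi : ℂ) ≠ 0 := by exact_mod_cast Real.pi_ne_zero
  field_simp

/-! ### The integrand of the tube formula -/

lemma exists_norm_generatorSum_le {d : ℕ} {G : Set (E d)} (κ : ℕ → ℝ) (hg : 0 < inradius G)
    {η : ℝ} (hη : 0 < η) : ∃ C : ℝ, 0 ≤ C ∧ ∀ s : ℂ, (∀ k : ℕ, k ≤ d → η ≤ ‖s - k‖) →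
      ‖generatorSum G κ s‖ ≤ C * inradius G ^ s.re := by
  refine ⟨∑ k ∈ Finset.range (d + 1), inradius G ^ (-(k : ℝ)) / η * |κ k|,
    Finset.sum_nonneg fun k _ => ?_, fun s hs => ?_⟩
  · have := Real.rpow_pos_of_pos hg (-(k : ℝ))
    positivity
  · rw [generatorSum, Finset.sum_mul]
    refine (norm_sum_le _ _).trans (Finset.sum_le_sum fun k hk => ?_)
    have hk' := hs k (Nat.lt_succ_iff.1 (Finset.mem_range.1 hk))
    rw [norm_mul, norm_div, Complex.norm_cpow_eq_rpow_re_of_pos hg, Complex.norm_real,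
      Real.norm_eq_abs]
    have h1 : (s - (k : ℂ)).re = -(k : ℝ) + s.re := by simp; ring
    rw [h1, Real.rpow_add hg]
    have h2 : 0 < inradius G ^ (-(k : ℝ)) * inradius G ^ s.re :=
      mul_pos (Real.rpow_pos_of_pos hg _) (Real.rpow_pos_of_pos hg _)
    calc inradius G ^ (-(k : ℝ)) * inradius G ^ s.re / ‖s - k‖ * |κ k|
        ≤ inradius G ^ (-(k : ℝ)) * inradius G ^ s.re / η * |κ k| := by gcongr
      _ = _ := by ring

namespace SelfSimilarSystem

variable {d J : ℕ} (S : SelfSimilarSystem d J)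

/-- The tubular zeta function paired with a test function. -/
noncomputable def pairedZeta (G : Set (E d)) (κ : ℕ → ℝ) (φ : ℝ → ℂ) (s : ℂ) : ℂ :=
  S.scalingZeta s * generatorSum G κ s * powPairing (d - s) φ

/-- Each summand is a quotient of entire functions; splitting by `k` keeps the zeros of the
denominators simple wherever `κ k ≠ 0`. -/
lemma pairedZeta_eq_sum (G : Set (E d)) (κ : ℕ → ℝ) (φ : ℝ → ℂ) (s : ℂ) :
    S.pairedZeta G κ φ s = ∑ k ∈ Finset.range (d + 1),
      κ k * powPairing (d - s) φ * (inradius G : ℂ) ^ (s - k) / (S.denom s * (s - k)) := by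
  rw [pairedZeta, scalingZeta_eq, generatorSum, Finset.mul_sum, Finset.sum_mul]
  refine Finset.sum_congr rfl fun k _ => ?_
  rw [div_eq_mul_inv, div_eq_mul_inv, mul_inv]
  ring

variable {S} {G : Set (E d)} {κ : ℕ → ℝ} {φ : ℝ → ℂ} {a b : ℝ}

lemma differentiable_numerator (hφ : IsSmoothSupportedOn a b φ) (ha : 0 < a)
    (hg : 0 < inradius G) (k : ℕ) :
    Differentiable ℂ fun s => κ k * powPairing (d - s) φ * (inradius G : ℂ) ^ (s - k) := by
  have h1 : Differentiable ℂ fun s : ℂ => powPairing ((d : ℂ) - s) φ :=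
    (hφ.differentiable_powPairing ha).comp (differentiable_id.const_sub _)
  refine (h1.const_mul _).mul fun s => ?_
  exact (differentiableAt_id.sub_const _).const_cpow (Or.inl (by exact_mod_cast hg.ne'))

lemma differentiable_denominator (k : ℕ) :
    Differentiable ℂ fun s => S.denom s * (s - k) :=
  S.differentiable_denom.mul (differentiable_id.sub_const _)

lemma continuousOn_pairedZeta (hφ : IsSmoothSupportedOn a b φ) (ha : 0 < a)
    (hg : 0 < inradius G) {Ω : Set ℂ} (h1 : ∀ s ∈ Ω, S.denom s ≠ 0)
    (h2 : ∀ s ∈ Ω, ∀ k : ℕ, k ≤ d → s ≠ k) : ContinuousOn (S.pairedZeta G κ φ) Ω := by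
  rw [show S.pairedZeta G κ φ = _ from funext (S.pairedZeta_eq_sum G κ φ)]
  refine continuousOn_finsetSum _ fun k hk => ?_
  refine (differentiable_numerator hφ ha hg k).continuous.continuousOn.div
    (differentiable_denominator k).continuous.continuousOn fun s hs => ?_
  exact mul_ne_zero (h1 s hs) (sub_ne_zero.2 (h2 s hs k (Nat.lt_succ_iff.1 (Finset.mem_range.1 hk))))

lemma deriv_denominator (k : ℕ) (w : ℂ) :
    deriv (fun s => S.denom s * (s - k)) w = S.denom w + (w - k) * deriv S.denom w :=
  deriv_eq_of_eq_sub_mul S.differentiable_denom fun _ => mul_comm _ _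

lemma rectIntegral_summand (hφ : IsSmoothSupportedOn a b φ) (ha : 0 < a) (hg : 0 < inradius G)
    (hζs : HasOnlySimplePoles S.scalingZeta) {k : ℕ} (hk : k ≤ d) (hκk : S.denom k = 0 → κ k = 0)
    {R c T₁ T₂ : ℝ} (hc1 : (d : ℝ) - 1 < c) (hc2 : c < d) (hR : 0 < R) (hRc : -R ≤ c)
    (hT₁ : T₁ < 0) (hT₂ : 0 < T₂) (hc : S.moran c < 1) (Z : Finset ℂ)
    (hZ : ∀ s : ℂ, s.im ∈ Icc T₁ T₂ → (S.denom s = 0 ↔ s ∈ Z))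
    (hZR : ∀ w ∈ Z, -R < w.re ∧ w.im ∈ Ioo T₁ T₂) :
    rectIntegral (fun s => κ k * powPairing (d - s) φ * (inradius G : ℂ) ^ (s - k) /
      (S.denom s * (s - k))) (-R) c T₁ T₂ = 2 * Real.pi * Complex.I *
      (∑ w ∈ Z, residue S.scalingZeta w * powPairing (d - w) φ *
        ((inradius G : ℂ) ^ (w - k) / (w - k) * κ k) +
        if k < d then κ k * S.scalingZeta k * powPairing (d - k) φ else 0) := by
  -- If `κ k = 0` the summand vanishes identically, even where its denominator has a double zero.
  -- Otherwise `k` is not a zero of `denom`.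
  by_cases hκ0 : κ k = 0
  · simp only [hκ0, Complex.ofReal_zero, zero_mul, zero_div, mul_zero, ite_self, add_zero,
      Finset.sum_const_zero]
    exact rectIntegral_zero _ _ _ _
  have hdk : S.denom k ≠ 0 := fun h => hκ0 (hκk h)
  have hdZ : ∀ w ∈ Z, S.denom w = 0 := fun w hw =>
    (hZ w (Ioo_subset_Icc_self (hZR w hw).2)).2 hw
  have hwk : ∀ w ∈ Z, w - k ≠ 0 := fun w hw h => hdk (by rw [← sub_eq_zero.1 h]; exact hdZ w hw)
  have hwc : ∀ w ∈ Z, w.re < c := fun w hw => by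
    by_contra! h
    exact S.denom_ne_zero ((S.moran_antitone h).trans_lt hc) (hdZ w hw)
  have hkZ : (k : ℂ) ∉ Z := fun h => hdk (hdZ _ h)
  have hterm : ∀ w ∈ Z, κ k * powPairing (d - w) φ * (inradius G : ℂ) ^ (w - k) /
      deriv (fun s => S.denom s * (s - k)) w = residue S.scalingZeta w * powPairing (d - w) φ *
        ((inradius G : ℂ) ^ (w - k) / (w - k) * κ k) := by
    intro w hw
    rw [deriv_denominator, hdZ w hw, zero_add, S.residue_scalingZeta hζs (hdZ w hw)]
    have h1 := hwk w hw
    have h2 := S.deriv_denom_ne_zero hζs (hdZ w hw)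
    field_simp
  have hdne : ∀ w ∈ Z, deriv (fun s => S.denom s * (s - k)) w ≠ 0 := by
    intro w hw
    rw [deriv_denominator, hdZ w hw, zero_add]
    exact mul_ne_zero (hwk w hw) (S.deriv_denom_ne_zero hζs (hdZ w hw))
  by_cases hkd : k < d
  · have hkc : (k : ℝ) < c := by
      have : (k : ℝ) + 1 ≤ d := by exact_mod_cast hkd
      linarith
    rw [rectIntegral_div hRc (hT₁.trans hT₂).le (insert (k : ℂ) Z)
      (differentiable_numerator hφ ha hg k) (differentiable_denominator k)]
    · rw [Finset.sum_insert hkZ, if_pos hkd, Finset.sum_congr rfl hterm, add_comm]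
      congr 2
      rw [deriv_denominator, sub_self, zero_mul, add_zero, Complex.cpow_zero, scalingZeta_eq]
      ring
    · intro s hs
      rw [mul_eq_zero, sub_eq_zero, hZ s hs.2, Finset.mem_insert, or_comm]
    · intro w hw
      rcases Finset.mem_insert.1 hw with rfl | hw
      · refine ⟨⟨?_, by simpa using hkc⟩, ⟨by simpa using hT₁, by simpa using hT₂⟩⟩
        have : (0 : ℝ) ≤ k := Nat.cast_nonneg k
        simp only [Complex.natCast_re]
        linarith
      · exact ⟨⟨(hZR w hw).1, hwc w hw⟩, (hZR w hw).2⟩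
    · intro w hw
      rcases Finset.mem_insert.1 hw with rfl | hw
      · rw [deriv_denominator, sub_self, zero_mul, add_zero]
        exact hdk
      · exact hdne w hw
  -- The point `d` is to the right of the edge `Re s = c`, so only zeros of `denom` are enclosed.
  · have hkd' : k = d := le_antisymm hk (not_lt.1 hkd)
    rw [rectIntegral_div hRc (hT₁.trans hT₂).le Z
      (differentiable_numerator hφ ha hg k) (differentiable_denominator k)]
    · rw [if_neg hkd, add_zero, Finset.sum_congr rfl hterm]
    · intro s hs
      have hsk : s - k ≠ 0 := by
        intro h
        have h1 : s.re = d := by rw [sub_eq_zero.1 h, hkd']; simp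
        have h2 : s.re ≤ c := hs.1.2
        linarith
      rw [mul_eq_zero, hZ s hs.2]
      simp [hsk]
    · exact fun w hw => ⟨⟨(hZR w hw).1, hwc w hw⟩, (hZR w hw).2⟩
    · exact hdne

/-- The partial sum of the tube formula, paired with a test function. -/
noncomputable def formulaSum (S : SelfSimilarSystem d J) (G : Set (E d)) (κ : ℕ → ℝ) (φ : ℝ → ℂ)
    (D : Set ℂ) : ℂ :=
  (∑ᶠ z ∈ D, residue S.scalingZeta z * powPairing ((d : ℂ) - z) φ *
    ∑ k ∈ Finset.range (d + 1), (inradius G : ℂ) ^ (z - k) / (z - k) * κ k) +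
  ∑ k ∈ Finset.range d, (κ k : ℂ) * S.scalingZeta k * powPairing ((d : ℂ) - k) φ

lemma rectIntegral_pairedZeta (hφ : IsSmoothSupportedOn a b φ) (ha : 0 < a) (hg : 0 < inradius G)
    (hζs : HasOnlySimplePoles S.scalingZeta) (hκ : ∀ k ≤ d, S.denom k = 0 → κ k = 0)
    {R c T₁ T₂ : ℝ} (hc1 : (d : ℝ) - 1 < c) (hc2 : c < d) (hR : 0 < R) (hRc : -R ≤ c)
    (hT₁ : T₁ < 0) (hT₂ : 0 < T₂) (hc : S.moran c < 1)
    (hRz : ∀ s : ℂ, S.denom s = 0 → -R < s.re)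
    (hz₁ : ∀ s : ℂ, s.im = T₁ → S.denom s ≠ 0) (hz₂ : ∀ s : ℂ, s.im = T₂ → S.denom s ≠ 0)
    {D : Set ℂ} (hD : ∀ s, s ∈ D ↔ S.denom s = 0 ∧ T₁ < s.im ∧ s.im < T₂) (hDf : D.Finite) :
    rectIntegral (S.pairedZeta G κ φ) (-R) c T₁ T₂ =
      2 * Real.pi * Complex.I * S.formulaSum G κ φ D := by
  have hT : T₁ < T₂ := hT₁.trans hT₂
  rw [show S.pairedZeta G κ φ = _ from funext (S.pairedZeta_eq_sum G κ φ),
    rectIntegral_sum _ hRc hT.le]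
  · have hs : ∀ k ∈ Finset.range (d + 1), _ := fun k hk =>
      rectIntegral_summand (κ := κ) hφ ha hg hζs (Nat.lt_succ_iff.1 (Finset.mem_range.1 hk))
        (hκ k (Nat.lt_succ_iff.1 (Finset.mem_range.1 hk))) hc1 hc2 hR hRc hT₁ hT₂ hc
        hDf.toFinset (fun s hs => by
          rw [hDf.mem_toFinset, hD]
          refine ⟨fun h0 => ⟨h0, lt_of_le_of_ne hs.1 fun h => hz₁ s h.symm h0,
            lt_of_le_of_ne hs.2 fun h => hz₂ s h h0⟩, fun h => h.1⟩)
        (fun w hw => by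
          rw [hDf.mem_toFinset, hD] at hw
          exact ⟨hRz w hw.1, hw.2⟩)
    rw [Finset.sum_congr rfl hs, ← Finset.mul_sum, formulaSum, finsum_mem_eq_finite_toFinset_sum _ hDf,
      Finset.sum_add_distrib, Finset.sum_comm]
    congr 2
    · exact Finset.sum_congr rfl fun w _ => by rw [Finset.mul_sum]
    · rw [Finset.sum_range_succ, if_neg (lt_irrefl d), add_zero]
      exact Finset.sum_congr rfl fun k hk => if_pos (Finset.mem_range.1 hk)
  · intro k hk
    refine (differentiable_numerator hφ ha hg k).continuous.continuousOn.div
      (differentiable_denominator k).continuous.continuousOn ?_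
    have hkd : (k : ℝ) ≤ d := by exact_mod_cast Nat.lt_succ_iff.1 (Finset.mem_range.1 hk)
    have hkc : (k : ℝ) ≠ c := by
      rcases (Nat.lt_succ_iff.1 (Finset.mem_range.1 hk)).lt_or_eq with h | h
      · have : (k : ℝ) + 1 ≤ d := by exact_mod_cast h
        exact (by linarith : (k : ℝ) < c).ne
      · rw [h]; exact hc2.ne'
    have hk0 : (0 : ℝ) ≤ k := Nat.cast_nonneg k
    intro s hs
    refine mul_ne_zero ?_ (sub_ne_zero.2 ?_)
    · rcases hs with ⟨-, h | h⟩ | ⟨-, h | h⟩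
      · exact hz₁ s h
      · exact hz₂ s h
      · exact fun h0 => absurd (hRz s h0) (by linarith)
      · exact S.denom_ne_zero (by rwa [h])
    · rintro rfl
      rcases hs with ⟨-, h | h⟩ | ⟨-, h | h⟩ <;> simp at h
      · exact hT₁.ne h.symm
      · exact hT₂.ne h
      · linarith
      · exact hkc h

end SelfSimilarSystem

namespace SelfSimilarSystem

variable {d J : ℕ} {S : SelfSimilarSystem d J} {F G : Set (E d)} {κ : ℕ → ℝ} {φ : ℝ → ℂ} {a b : ℝ}

/-! ### Bounds for the integrand -/

lemma IsGenerator.exists_abscissa (h : S.IsGenerator F G) :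
    ∃ c : ℝ, (d : ℝ) - 1 < c ∧ c < d ∧ S.moran c < 1 := by
  have h1 : ∀ᶠ c in 𝓝[<] (d : ℝ), S.moran c < 1 :=
    nhdsWithin_le_nhds (S.continuous_moran.continuousAt.eventually (gt_mem_nhds h.moran_lt_one))
  obtain ⟨c, hc, hc'⟩ := (h1.and (Ioo_mem_nhdsLT (show (d : ℝ) - 1 < d by linarith))).exists
  exact ⟨c, hc'.1, hc'.2, hc⟩

lemma exists_norm_pairedZeta_le (hφ : IsSmoothSupportedOn a b φ) (ha : 0 < a) (hab : a ≤ b)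
    (hg : 0 < inradius G) (κ : ℕ → ℝ) {η : ℝ} (hη : 0 < η) (N : ℕ) :
    ∃ C : ℝ, 0 ≤ C ∧ ∀ s : ℂ, s.re ≤ d → (∀ k : ℕ, k ≤ d → η ≤ ‖s - k‖) →
      ‖S.pairedZeta G κ φ s‖ ≤ ‖S.scalingZeta s‖ *
        (C * Real.exp ((Real.log (inradius G) - Real.log b) * s.re) / (1 + |s.im|) ^ N) := by
  obtain ⟨C₁, h1, hle1⟩ := exists_norm_generatorSum_le κ hg hη
  obtain ⟨C₂, h2, hle2⟩ := hφ.exists_norm_powPairing_le ha hab N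
  have hb : 0 < b := ha.trans_le hab
  refine ⟨C₁ * C₂ * b ^ (d : ℝ), by positivity, fun s hs hk => ?_⟩
  have e1 := hle1 s hk
  have e2 := hle2 (d - s) (by simp; linarith)
  have hre : ((d : ℂ) - s).re = d + -s.re := by simp; ring
  have him : |((d : ℂ) - s).im| = |s.im| := by simp
  rw [hre, him, Real.rpow_add hb] at e2
  have hexp : Real.exp ((Real.log (inradius G) - Real.log b) * s.re) =
      inradius G ^ s.re * b ^ (-s.re) := by
    rw [Real.rpow_def_of_pos hg, Real.rpow_def_of_pos hb, ← Real.exp_add]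
    congr 1
    ring
  have hp : 0 < inradius G ^ s.re := Real.rpow_pos_of_pos hg _
  rw [pairedZeta, norm_mul, norm_mul, mul_assoc]
  refine mul_le_mul_of_nonneg_left ?_ (norm_nonneg _)
  calc ‖generatorSum G κ s‖ * ‖powPairing (d - s) φ‖
      ≤ (C₁ * inradius G ^ s.re) * (C₂ * (b ^ (d : ℝ) * b ^ (-s.re)) / (1 + |s.im|) ^ N) :=
        mul_le_mul e1 e2 (norm_nonneg _) (by positivity)
    _ = _ := by rw [hexp]; ring

lemma le_norm_sub_natCast_of_im {s : ℂ} {η : ℝ} (h : η ≤ |s.im|) (k : ℕ) : η ≤ ‖s - k‖ := by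
  refine h.trans ?_
  simpa using Complex.abs_im_le_norm (s - k)

lemma le_norm_sub_natCast_of_re {s : ℂ} {η : ℝ} {k : ℕ} (h : η ≤ |s.re - k|) : η ≤ ‖s - k‖ := by
  refine h.trans ?_
  simpa using Complex.abs_re_le_norm (s - k)

/-- Ensures that the horizontal edges of the contour avoid the poles. -/
lemma _root_.TubeFormula.IsLanguidSequence.denom_ne_zero {T : ℤ → ℝ}
    (hT : IsLanguidSequence S.scalingZeta T) (n : ℤ) {s : ℂ} (hs : s.im = T n) :
    S.denom s ≠ 0 := by
  obtain ⟨-, -, -, -, c, M, -, -, hle⟩ := hT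
  have := S.denom_ne_zero_of_bounded (T := T n) (K := c * (|T n| + 1) ^ M)
    (fun σ => by simpa [scalingZeta_eq] using hle n σ) s.re
  rwa [← hs, Complex.re_add_im] at this

/-- The integral of the tube volume against a test function, as an integral over a vertical
line. -/
lemma IsGenerator.integral_tubeVolume_mul (h : S.IsGenerator F G) (hg : 0 < inradius G)
    (hκ : IsMonophaseWith G κ) (hφ : IsSmoothSupportedOn a b φ) (ha : 0 < a) (hab : a ≤ b)
    {c : ℝ} (hc1 : (d : ℝ) - 1 < c) (hc2 : c < d) (hc : S.moran c < 1) :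
    IntegrableOn (fun ε => (tubeVolume (⋃ w, S.wordSim w '' G) ε : ℂ) * φ ε) (Ioi 0) ∧
    ∫ ε in Ioi (0 : ℝ), (tubeVolume (⋃ w, S.wordSim w '' G) ε : ℂ) * φ ε =
      (1 / (2 * Real.pi)) * ∫ y : ℝ, S.pairedZeta G κ φ (c + y * Complex.I) := by
  have hmel : ∀ y : ℝ, _ := fun y => h.hasMellin_tiling (s := c + y * Complex.I) hg hκ
    (by simpa using hc1) (by simpa using hc2) (by simpa using hc)
  have hV := (hmel 0).1
  -- With `σ = d - c + 1` and `s = c + iy`, the transform of `V` is taken at `s - d` and that of `φ`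
  -- at `d - s + 1`, which is `powPairing (d - s) φ`.
  have hσ : (1 : ℂ) - ((d - c + 1 : ℝ) : ℂ) = c - d := by push_cast; ring
  rw [Complex.ofReal_zero, zero_mul, add_zero, ← hσ] at hV
  obtain ⟨h1, h2⟩ := integral_mul_eq_mellin hφ ha hab
    (Complex.measurable_ofReal.comp (measurable_tubeVolume h.isBounded_iUnion))
    (show (1 : ℝ) ≤ d - c + 1 by linarith) hV
  refine ⟨h1, h2.trans ?_⟩
  congr 2
  ext y
  rw [pairedZeta, powPairing_eq_mellin, ← (hmel y).2, hσ]
  congr 2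
  · ring
  · push_cast; ring

lemma integrable_pairedZeta_line (hφ : IsSmoothSupportedOn a b φ) (ha : 0 < a) (hab : a ≤ b)
    (hg : 0 < inradius G) {c : ℝ} (hc1 : (d : ℝ) - 1 < c) (hc2 : c < d) (hc : S.moran c < 1) :
    Integrable fun y : ℝ => S.pairedZeta G κ φ (c + y * Complex.I) := by
  -- A lower bound for the distance from the line to the points `0, …, d`.
  have hck : ∀ k : ℕ, k ≤ d → min (c - (d - 1)) (d - c) ≤ |c - k| := by
    intro k hk
    rcases hk.lt_or_eq with hk | rfl
    · have : (k : ℝ) + 1 ≤ d := by exact_mod_cast hk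
      exact (min_le_left _ _).trans ((by linarith : c - (d - 1) ≤ c - k).trans (le_abs_self _))
    · rw [abs_sub_comm]
      exact (min_le_right _ _).trans (le_abs_self _)
  have hη : 0 < min (c - ((d : ℝ) - 1)) (d - c) := lt_min (by linarith) (by linarith)
  obtain ⟨C, hC, hle⟩ := exists_norm_pairedZeta_le (S := S) hφ ha hab hg κ hη 2
  have hcont : Continuous fun y : ℝ => S.pairedZeta G κ φ (c + y * Complex.I) := by
    rw [← continuousOn_univ]
    refine (continuousOn_pairedZeta (Ω := {s | s.re = c}) hφ ha hg (fun s hs => ?_)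
      fun s hs k hk h => ?_).comp (by fun_prop) fun y _ => by simp
    · exact S.denom_ne_zero (by rwa [show s.re = c from hs])
    · have h1 := hck k hk
      have h2 : c = k := by rw [← show s.re = c from hs, h]; simp
      rw [h2, sub_self, abs_zero, ← h2] at h1
      exact absurd h1 (not_le.2 hη)
  set K := (1 - S.moran c)⁻¹ *
    (C * Real.exp ((Real.log (inradius G) - Real.log b) * c)) with hK
  have hm : 0 < 1 - S.moran c := by linarith
  refine (integrable_inv_one_add_sq.const_mul K).mono' hcont.aestronglyMeasurable
    (.of_forall fun y => ?_)
  have h1 := hle (c + y * Complex.I) (by simpa using hc2.le) fun k hk =>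
    le_norm_sub_natCast_of_re (by simpa using hck k hk)
  have h2 : ‖S.scalingZeta (c + y * Complex.I)‖ ≤ (1 - S.moran c)⁻¹ := by
    rw [scalingZeta_eq, norm_inv]
    refine inv_anti₀ hm ?_
    simpa using S.one_sub_moran_le (c + y * Complex.I)
  have hre : ((c : ℂ) + y * Complex.I).re = c := by simp
  have him : ((c : ℂ) + y * Complex.I).im = y := by simp
  rw [hre, him] at h1
  refine h1.trans ((mul_le_mul_of_nonneg_right h2 (by positivity)).trans ?_)
  rw [hK, mul_assoc, div_eq_mul_inv]
  refine mul_le_mul_of_nonneg_left (mul_le_mul_of_nonneg_left (inv_anti₀ (by positivity) ?_)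
    (by positivity)) (by positivity)
  nlinarith [abs_nonneg y, sq_abs y]

/-! ### The tube formula -/

theorem IsGenerator.tube_formula (h : S.IsGenerator F G) (hg : 0 < inradius G)
    (hκ : IsMonophaseWith G κ) (hζs : HasOnlySimplePoles S.scalingZeta)
    (hcoef : ∀ k ≤ d, S.denom k = 0 → κ k = 0) {T : ℤ → ℝ}
    (hT : IsLanguidSequence S.scalingZeta T) {j₀ : Fin J} (hj₀ : ∀ j, S.ratio j₀ ≤ S.ratio j)
    (hφ : IsSmoothSupportedOn a b φ) (ha : 0 < a) (hab : a ≤ b)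
    (hb : b * S.ratio j₀ < inradius G) :
    IntegrableOn (fun ε => (tubeVolume (⋃ w, S.wordSim w '' G) ε : ℂ) * φ ε) (Ioi 0) ∧
    Tendsto (fun n : ℕ => S.formulaSum G κ φ (truncated S.scalingDims T n)) atTop
      (𝓝 (∫ ε in Ioi (0 : ℝ), (tubeVolume (⋃ w, S.wordSim w '' G) ε : ℂ) * φ ε)) := by
  obtain ⟨c, hc1, hc2, hc⟩ := h.exists_abscissa
  obtain ⟨hint, heq⟩ := h.integral_tubeVolume_mul hg hκ hφ ha hab hc1 hc2 hc
  refine ⟨hint, ?_⟩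
  rw [heq]
  obtain ⟨hTpos, hTtop, hTbot, -, c₀, M, hc₀, hM, hlang⟩ := id hT
  obtain ⟨σ₀, hσ₀, hden⟩ := S.exists_le_norm_denom hj₀
  set N := ⌈M⌉₊ with hN
  -- `N` powers of decay absorb the growth of `ζ_s`; one more is left over for the horizontal edges.
  obtain ⟨C, hC, hle⟩ := exists_norm_pairedZeta_le (S := S) hφ ha hab hg κ one_pos (N + 1)
  have hb0 : 0 < b := ha.trans_le hab
  have hρ := S.ratio_pos j₀
  set m := Real.log (inradius G) - Real.log b with hm
  -- `l = log (g / (b ρ))`, positive exactly because `b ρ < g`.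
  set l := m - Real.log (S.ratio j₀) with hl
  have hl0 : 0 < l := by
    have := Real.log_lt_log (by positivity) hb
    rw [Real.log_mul hb0.ne' hρ.ne'] at this
    rw [hl, hm]
    linarith
  -- The bound `-1` keeps the left region at distance at least `1` from the points `0, …, d`.
  set σ₁ := min σ₀ (-1) with hσ₁
  have hσ₁0 : σ₁ ≤ σ₀ := min_le_left _ _
  have hσ₁1 : σ₁ ≤ -1 := min_le_right _ _
  have hdpos : (0 : ℝ) ≤ d := Nat.cast_nonneg d
  have hleft : ∀ s : ℂ, s.re ≤ σ₁ →
      ‖S.pairedZeta G κ φ s‖ ≤ 2 * C * Real.exp (l * s.re) / (1 + |s.im|) := by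
    intro s hs
    have h1 := hle s (by linarith) fun k _ => le_norm_sub_natCast_of_re (by
      have : (0 : ℝ) ≤ k := Nat.cast_nonneg k
      rw [abs_of_neg (by linarith)]
      linarith)
    have h2 : ‖S.scalingZeta s‖ ≤ 2 * S.ratio j₀ ^ (-s.re) := by
      have hp := Real.rpow_pos_of_pos hρ s.re
      rw [scalingZeta_eq, norm_inv, Real.rpow_neg hρ.le]
      refine (inv_anti₀ (by positivity) (hden s (hs.trans hσ₁0))).trans (le_of_eq ?_)
      rw [inv_div, div_eq_mul_inv]
    have h3 : S.ratio j₀ ^ (-s.re) * Real.exp (m * s.re) = Real.exp (l * s.re) := by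
      rw [Real.rpow_def_of_pos hρ, ← Real.exp_add, hl]
      congr 1
      ring
    have h4 : (1 + |s.im|) ≤ (1 + |s.im|) ^ (N + 1) :=
      le_self_pow₀ (by linarith [abs_nonneg s.im]) (by omega)
    calc ‖S.pairedZeta G κ φ s‖ ≤ _ := h1
      _ ≤ (2 * S.ratio j₀ ^ (-s.re)) * (C * Real.exp (m * s.re) / (1 + |s.im|)) := by
          gcongr
      _ = 2 * C * (S.ratio j₀ ^ (-s.re) * Real.exp (m * s.re)) / (1 + |s.im|) := by ring
      _ = _ := by rw [h3]
  set B := |σ₁| + |c| with hB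
  -- For `σ` in the bounded range `[σ₁, c]`, replacing `exp (m * σ)` by `exp (l * σ)` costs only the
  -- factor `exp ((|m| + l) * B)`.
  set C' := c₀ * C * Real.exp ((|m| + l) * B) with hC'
  have hC'0 : 0 ≤ C' := by positivity
  have hmid : ∀ n : ℤ, 1 ≤ |T n| → ∀ σ : ℝ, σ₁ ≤ σ → σ ≤ c →
      ‖S.pairedZeta G κ φ (σ + T n * Complex.I)‖ ≤ C' * Real.exp (l * σ) / (1 + |T n|) := by
    intro n hn σ h1 h2
    have hre : ((σ : ℂ) + T n * Complex.I).re = σ := by simp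
    have him : ((σ : ℂ) + T n * Complex.I).im = T n := by simp
    have h3 := hle (σ + T n * Complex.I) (by rw [hre]; linarith) fun k _ =>
      le_norm_sub_natCast_of_im (by rwa [him]) k
    rw [hre, him] at h3
    have h4 : ‖S.scalingZeta (σ + T n * Complex.I)‖ ≤ c₀ * (1 + |T n|) ^ N := by
      refine (hlang n σ).trans (mul_le_mul_of_nonneg_left ?_ hc₀.le)
      rw [add_comm, ← Real.rpow_natCast]
      exact Real.rpow_le_rpow_of_exponent_le (by linarith) (Nat.le_ceil M)
    have h5 : |σ| ≤ B := by
      rw [abs_le]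
      constructor
      · linarith [neg_abs_le σ₁, abs_nonneg c]
      · linarith [le_abs_self c, abs_nonneg σ₁]
    have h6 : Real.exp (m * σ) ≤ Real.exp ((|m| + l) * B) * Real.exp (l * σ) := by
      rw [← Real.exp_add, Real.exp_le_exp]
      have h7 : m * σ ≤ |m| * B := by
        refine (le_abs_self _).trans ?_
        rw [abs_mul]
        exact mul_le_mul_of_nonneg_left h5 (abs_nonneg m)
      have h8 : -(l * B) ≤ l * σ := by
        have := neg_abs_le σ
        nlinarith
      linarith
    have hpos : 0 < 1 + |T n| := by linarith [abs_nonneg (T n)]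
    calc _ ≤ _ := h3
      _ ≤ (c₀ * (1 + |T n|) ^ N) * (C * (Real.exp ((|m| + l) * B) * Real.exp (l * σ)) /
            (1 + |T n|) ^ (N + 1)) := by gcongr
      _ = _ := by
          rw [hC', pow_succ]
          field_simp
  refine tendsto_of_rectIntegral (C := 2 * C + C') (σ₀ := σ₁) hl0 (by positivity)
    (integrable_pairedZeta_line hφ ha hab hg hc1 hc2 hc) (fun s hs => ?_) (fun n hn σ hσ => ?_)
    (fun n h1 h2 => ?_) hTtop hTbot
  · refine (hleft s hs).trans ((div_le_self (by positivity)
      (by linarith [abs_nonneg s.im])).trans ?_)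
    exact mul_le_mul_of_nonneg_right (by linarith) (Real.exp_pos _).le
  · rcases le_total σ σ₁ with hσ' | hσ'
    · have := hleft (σ + T n * Complex.I) (by simpa using hσ')
      simp only [Complex.add_re, Complex.ofReal_re, Complex.mul_re, Complex.I_re, mul_zero,
        Complex.ofReal_im, Complex.I_im, mul_one, sub_self, add_zero, Complex.add_im,
        Complex.mul_im, zero_add] at this
      refine this.trans ?_
      gcongr
      linarith
    · refine (hmid n hn σ hσ' hσ).trans ?_
      gcongr
      linarith
  · obtain ⟨ν₀, ν₁, -, hstrip⟩ := S.exists_zeros_subset_strip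
    filter_upwards [eventually_ge_atTop (-ν₀), eventually_gt_atTop 0, eventually_ge_atTop (-c)]
      with R hR1 hR2 hR3
    refine rectIntegral_pairedZeta hφ ha hg hζs hcoef hc1 hc2 hR2 (by linarith) (by linarith)
      (by linarith) hc (fun s hs => by linarith [(hstrip s hs).1])
      (fun s hs => hT.denom_ne_zero _ hs) (fun s hs => hT.denom_ne_zero _ hs) (fun s => ?_)
      (S.finite_truncated T n)
    rw [scalingDims_eq]
    rfl

end SelfSimilarSystem

/-! ### From compactly supported test functions to the final statement -/

/-- The extreme points of the compact support lie in `U`, which yields the strict inequalities `0 <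
a` and `b ρ < g` needed for the decay on the left. -/
lemma IsTestFunctionOn.exists_isSmoothSupportedOn {U : Set ℝ} {φ : ℝ → ℂ}
    (hφ : IsTestFunctionOn U φ) (hU : U.Nonempty) :
    ∃ a ∈ U, ∃ b ∈ U, a ≤ b ∧ IsSmoothSupportedOn a b φ := by
  obtain ⟨h1, h2, h3⟩ := hφ
  rcases (tsupport φ).eq_empty_or_nonempty with he | hne
  · obtain ⟨u, hu⟩ := hU
    refine ⟨u, hu, u, hu, le_rfl, h1, (subset_tsupport φ).trans ?_⟩
    rw [he]
    exact empty_subset _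
  · obtain ⟨a, ha, hmin⟩ := h2.isCompact.exists_isLeast hne
    obtain ⟨b, hb, hmax⟩ := h2.isCompact.exists_isGreatest hne
    exact ⟨a, h3 ha, b, h3 hb, hmin hb, h1, fun x hx =>
      ⟨hmin (subset_tsupport φ hx), hmax (subset_tsupport φ hx)⟩⟩

/-- The tube formula of a self-similar tiling with a monophase generator, for test functions on
the interval `(0, g / min_j r_j)`. -/
theorem tube_formula_of_support_subset_iUnion {d J : ℕ} (S : SelfSimilarSystem d J)
    (F : Set (E d)) (hF : S.IsAttractor F) (hT : S.TilesetCondition F) (G : Set (E d))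
    (hG : S.generators F = {G}) (hg : 0 < inradius G) (κ : ℕ → ℝ) (hκ : IsMonophaseWith G κ)
    (hζT : ∀ ε : ℝ, 0 < ε → HasOnlySimplePoles (S.tubularZeta G κ ε))
    (hζs : HasOnlySimplePoles S.scalingZeta) {T : ℤ → ℝ}
    (hTl : IsLanguidSequence S.scalingZeta T) {φ : ℝ → ℂ}
    (hφ : IsTestFunctionOn (⋃ j, Ioo 0 (inradius G / S.ratio j)) φ) :
    IntegrableOn (fun ε : ℝ => (tubeVolume (⋃₀ S.tiling F) ε : ℂ) * φ ε) (Ioi 0) ∧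
    Tendsto (fun n : ℕ => S.formulaSum G κ φ (truncated S.scalingDims T n)) atTop
      (𝓝 (∫ ε in Ioi (0 : ℝ), (tubeVolume (⋃₀ S.tiling F) ε : ℂ) * φ ε)) := by
  have hgen := SelfSimilarSystem.isGenerator hF hT hG hg
  obtain ⟨j₀, hj₀⟩ := S.exists_min_ratio
  have hne : (⋃ j, Ioo 0 (inradius G / S.ratio j)).Nonempty :=
    (nonempty_Ioo.2 (div_pos hg (S.ratio_pos j₀))).mono
      (subset_iUnion (fun j => Ioo 0 (inradius G / S.ratio j)) j₀)
  obtain ⟨a, ha, b, hb, hab, hφs⟩ := hφ.exists_isSmoothSupportedOn hne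
  obtain ⟨i, hai⟩ := mem_iUnion.1 ha
  obtain ⟨j, hbj⟩ := mem_iUnion.1 hb
  rw [SelfSimilarSystem.sUnion_tiling hG]
  refine hgen.tube_formula hg hκ hζs
    (fun k hk => S.coeff_eq_zero_of_pole hg hζT hζs hk) hTl hj₀ hφs hai.1 hab ?_
  calc b * S.ratio j₀ ≤ b * S.ratio j := mul_le_mul_of_nonneg_left (hj₀ j) hbj.1.le
    _ < inradius G := (lt_div_iff₀ (S.ratio_pos j)).1 hbj.2

end TubeFormula

theorem corollary8p4 {d J : ℕ} (S : SelfSimilarSystem d J) (F : Set (E d)) (hF : S.IsAttractor F)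
    (hT : S.TilesetCondition F) (G : Set (E d)) (hG : S.generators F = {G})
    (hg : 0 < inradius G) (κ : ℕ → ℝ) (hκ : IsMonophaseWith G κ)
    (hζT : ∀ ε : ℝ, 0 < ε → HasOnlySimplePoles (S.tubularZeta G κ ε))
    (hζs : HasOnlySimplePoles S.scalingZeta) :
    (∃ T : ℤ → ℝ, IsLanguidSequence S.scalingZeta T) ∧
    ∀ T : ℤ → ℝ, IsLanguidSequence S.scalingZeta T →
      (∀ n : ℕ, (truncated S.scalingDims T n).Finite) ∧
      ∀ φ : ℝ → ℂ, IsTestFunctionOn (⋂ j, Ioo 0 (inradius G / S.ratio j)) φ →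
        IntegrableOn (fun ε : ℝ => (tubeVolume (⋃₀ S.tiling F) ε : ℂ) * φ ε) (Ioi 0) ∧
        Tendsto
          (fun n : ℕ =>
            (∑ᶠ z ∈ truncated S.scalingDims T n,
              residue S.scalingZeta z * powPairing ((d : ℂ) - z) φ *
                ∑ k ∈ Finset.range (d + 1), (inradius G : ℂ) ^ (z - k) / (z - k) * κ k) +
            ∑ k ∈ Finset.range d,
              (κ k : ℂ) * S.scalingZeta k * powPairing ((d : ℂ) - k) φ)
          atTop (𝓝 (∫ ε in Ioi (0 : ℝ), (tubeVolume (⋃₀ S.tiling F) ε : ℂ) * φ ε)) := by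
  refine ⟨S.exists_isLanguidSequence, fun T hTl => ⟨S.finite_truncated T, fun φ hφ => ?_⟩⟩
  have : Nonempty (Fin J) := ⟨⟨0, by linarith [S.two_le]⟩⟩
  -- The intersection of the intervals is `(0, g / max_j r_j)`; it lies in their union `(0, g /
  -- min_j r_j)`, on which the formula is already established.
  exact tube_formula_of_support_subset_iUnion S F hF hT G hG hg κ hκ hζT hζs hTl
    ⟨hφ.1, hφ.2.1, hφ.2.2.trans (iInter_subset_iUnion)⟩
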